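/- Let $\mathcal{A}$ and $\mathcal{B}$ be exact categories (in the sense of Quillen: additive categories with a class of kernel–cokernel pairs $X\to Y\to Z$, called exact pairs, satisfying the usual axioms; the first map of an exact pair is called an inflation and the second a deflation). Let $F:\mathcal{A}\to\mathcal{B}$ be an additive functor with a left adjoint $L$ and a right adjoint $R$. Suppose that for every $X\in\mathcal{A}$ the counit $\epsilon_X: LFX\to X$ is a deflation and the unit $\eta_X: X\to RFX$ is an inflation, and that the class $\mathcal{P}$ of all direct summands of objects $LY$ ($Y\in\mathcal{B}$) coincides with the class of all direct summands of objects $RY$ ($Y\in\mathcal{B}$). Let $\underline{\mathcal{A}}_F=\mathcal{A}/\mathcal{P}$ be the category with the same objects as $\mathcal{A}$, in which $\mathrm{Hom}(X,Y)$ is $\mathrm{Hom}_{\mathcal{A}}(X,Y)$ modulo the relation $f\sim g$ iff $f-g$ factors through an object of $\mathcal{P}$. Call an exact pair of $\mathcal{A}$ *$F$-split* if it becomes split upon applying $F$. Then $\underline{\mathcal{A}}_F$ carries the structure of a triangulated category such that: 1. (Shift.) For every $F$-split exact pair $X\xrightarrow{i} I\xrightarrow{p} T$ with $I\in\mathcal{P}$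 there is an isomorphism $\theta: X[1]\cong T$ in $\underline{\mathcal{A}}_F$. These isomorphisms are natural: if $(f,g,h)$ is a morphism from such a pair $X\to I\to T$ to another such pair $X'\to I'\to T'$, then $\theta'\circ f[1]=h\circ\theta$ in $\underline{\mathcal{A}}_F$. 2. (Triangles.) The distinguished triangles are precisely the triangles isomorphic in $\underline{\mathcal{A}}_F$ to one of the form $$X\xrightarrow{u}Y\xrightarrow{v}Z\xrightarrow{\theta^{-1}w}X[1],$$ where $X\xrightarrow{u}Y\xrightarrow{v}Z$ is an $F$-split exact pair, $X\xrightarrow{i} I\xrightarrow{p} T$ is an $F$-split exact pair with $I\in\mathcal{P}$ and associated isomorphism $\theta: X[1]\cong T$, and $s:Y\to I$, $w:Z\to T$ are morphisms of $\mathcal{A}$ with $su=i$ and $wv=ps$. -/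

import Mathlib

open CategoryTheory CategoryTheory.Limits CategoryTheory.Pretriangulated
open scoped ZeroObject

universe v v' u u'

/-! ### Exact categories -/

/-- Given a class `E` of composable pairs with zero composition, `f` is an inflation if it is the
first map of a pair in `E`. -/
def IsInflationFor {C : Type u} [Category.{v} C] [Preadditive C]
    (E : ObjectProperty (ShortComplex C)) {X Y : C} (f : X ⟶ Y) : Prop :=
  ∃ (Z : C) (g : Y ⟶ Z) (w : f ≫ g = 0), E (ShortComplex.mk f g w)

/-- Given a class `E` of composable pairs with zero composition, `g` is a deflation if it is the
second map of a pair in `E`. -/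
def IsDeflationFor {C : Type u} [Category.{v} C] [Preadditive C]
    (E : ObjectProperty (ShortComplex C)) {Y Z : C} (g : Y ⟶ Z) : Prop :=
  ∃ (X : C) (f : X ⟶ Y) (w : f ≫ g = 0), E (ShortComplex.mk f g w)

/-- An exact structure (in the sense of Quillen) on an additive category: an isomorphism-closed
class of kernel-cokernel pairs, called exact pairs, satisfying the usual axioms. -/
structure ExactStructure (C : Type u) [Category.{v} C] [Preadditive C] [HasZeroObject C] [HasBinaryBiproducts C] where
  /-- the class of exact pairs -/
  exactPair : ObjectProperty (ShortComplex C)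
  of_iso : ∀ {S S' : ShortComplex C}, (S ≅ S') → exactPair S → exactPair S'
  isKernel : ∀ S : ShortComplex C, exactPair S → Nonempty (IsLimit (KernelFork.ofι S.f S.zero))
  isCokernel : ∀ S : ShortComplex C, exactPair S →
    Nonempty (IsColimit (CokernelCofork.ofπ S.g S.zero))
  inflation_id : ∀ X : C, IsInflationFor exactPair (𝟙 X)
  deflation_id : ∀ X : C, IsDeflationFor exactPair (𝟙 X)
  inflation_comp : ∀ {X Y Z : C} (f : X ⟶ Y) (g : Y ⟶ Z),
    IsInflationFor exactPair f → IsInflationFor exactPair g → IsInflationFor exactPair (f ≫ g)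
  deflation_comp : ∀ {X Y Z : C} (f : X ⟶ Y) (g : Y ⟶ Z),
    IsDeflationFor exactPair f → IsDeflationFor exactPair g → IsDeflationFor exactPair (f ≫ g)
  pushout : ∀ {X Y X' : C} (i : X ⟶ Y) (a : X ⟶ X'), IsInflationFor exactPair i →
    ∃ (Y' : C) (b : Y ⟶ Y') (i' : X' ⟶ Y'), IsPushout i a b i' ∧ IsInflationFor exactPair i'
  pullback : ∀ {Y Z Z' : C} (p : Y ⟶ Z) (a : Z' ⟶ Z), IsDeflationFor exactPair p →
    ∃ (Y' : C) (b : Y' ⟶ Y) (p' : Y' ⟶ Z'), IsPullback b p' p a ∧ IsDeflationFor exactPair p'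

/-! ### Relatively projective objects and the quotient category -/

/-- The class of all direct summands of objects in the image of a functor `G`. -/
def ImageSummand {A : Type u} [Category.{v} A] [Preadditive A] [HasZeroObject A] [HasBinaryBiproducts A]
    {B : Type u'} [Category.{v'} B] (G : B ⥤ A) : ObjectProperty A :=
  fun P => ∃ (Y : B) (Q : A), Nonempty (G.obj Y ≅ P ⊞ Q)

/-- Two parallel morphisms are related if their difference factors through an object of `P`. -/
def FactorsThroughRel {A : Type u} [Category.{v} A] [Preadditive A] (P : ObjectProperty A) :
    HomRel A :=
  fun X Y f g => ∃ (W : A) (_ : P W) (a : X ⟶ W) (b : W ⟶ Y), a ≫ b = f - g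

section

variable {A : Type u} [Category.{v} A] [Preadditive A] [HasZeroObject A] [HasBinaryBiproducts A]
  {B : Type u'} [Category.{v'} B]

theorem imageSummand_obj (G : B ⥤ A) (Y : B) : ImageSummand G (G.obj Y) :=
  ⟨Y, _, ⟨isoBiprodZero (isZero_zero A)⟩⟩

/-- A morphism factoring through a summand of an image object factors through an image object. -/
theorem factorsThrough_obj {L : B ⥤ A} {X Y : A} {f g : X ⟶ Y}
    (h : FactorsThroughRel (ImageSummand L) f g) :
    ∃ (V : B) (a : X ⟶ L.obj V) (b : L.obj V ⟶ Y), a ≫ b = f - g := by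
  obtain ⟨W, ⟨V, Q, ⟨e⟩⟩, a, b, hab⟩ := h
  exact ⟨V, a ≫ biprod.inl ≫ e.inv, e.hom ≫ biprod.fst ≫ b, by simp [hab]⟩

variable [Preadditive B] [HasBinaryBiproducts B]

theorem factorsThroughRel_of_add {L : B ⥤ A} [L.Additive] {X Y : A} {f₁ g₁ f₂ g₂ f g : X ⟶ Y}
    (h₁ : FactorsThroughRel (ImageSummand L) f₁ g₁)
    (h₂ : FactorsThroughRel (ImageSummand L) f₂ g₂)
    (e : (f₁ - g₁) + (f₂ - g₂) = f - g) : FactorsThroughRel (ImageSummand L) f g := by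
  obtain ⟨V₁, a₁, b₁, h₁⟩ := factorsThrough_obj h₁
  obtain ⟨V₂, a₂, b₂, h₂⟩ := factorsThrough_obj h₂
  refine ⟨_, imageSummand_obj L (V₁ ⊞ V₂),
    a₁ ≫ L.map biprod.inl + a₂ ≫ L.map biprod.inr,
    L.map biprod.fst ≫ b₁ + L.map biprod.snd ≫ b₂, ?_⟩
  have k₁ : L.map (biprod.inl : V₁ ⟶ V₁ ⊞ V₂) ≫ L.map biprod.fst = 𝟙 _ := by
    rw [← L.map_comp]; simp
  have k₂ : L.map (biprod.inr : V₂ ⟶ V₁ ⊞ V₂) ≫ L.map biprod.snd = 𝟙 _ := by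
    rw [← L.map_comp]; simp
  have k₃ : L.map (biprod.inl : V₁ ⟶ V₁ ⊞ V₂) ≫ L.map biprod.snd = 0 := by
    rw [← L.map_comp]; simp
  have k₄ : L.map (biprod.inr : V₂ ⟶ V₁ ⊞ V₂) ≫ L.map biprod.fst = 0 := by
    rw [← L.map_comp]; simp
  simp [reassoc_of% k₁, reassoc_of% k₂, reassoc_of% k₃, reassoc_of% k₄, h₁, h₂, e]

variable [HasZeroObject B]

theorem congruence_factorsThroughRel (L : B ⥤ A) [L.Additive] :
    Congruence (FactorsThroughRel (ImageSummand L)) where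
  equivalence :=
    { refl := fun f => ⟨_, imageSummand_obj L (0 : B), 0, 0, by simp⟩
      symm := by
        rintro f g ⟨W, hW, a, b, h⟩
        exact ⟨W, hW, a, -b, by simp [h]⟩
      trans := fun h₁ h₂ => factorsThroughRel_of_add h₁ h₂ (by abel) }
  comp_left := by
    rintro X Y Z f g g' ⟨W, hW, a, b, h⟩
    exact ⟨W, hW, f ≫ a, b, by simp [h]⟩
  comp_right := by
    rintro X Y Z f f' g ⟨W, hW, a, b, h⟩
    exact ⟨W, hW, a, b ≫ g, by rw [← Category.assoc, h, Preadditive.sub_comp]⟩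

/-- Given `L ⊣ F`, the quotient of `A` by the `F`-projective objects (the direct summands of
objects in the image of `L`): same objects as `A`, and morphisms those of `A` modulo the relation
that the difference factors through an `F`-projective object. -/
def FStable {F : A ⥤ B} {L : B ⥤ A} (_ : L ⊣ F) : Type u :=
  CategoryTheory.Quotient (FactorsThroughRel (ImageSummand L))

namespace FStable

variable {F : A ⥤ B} {L : B ⥤ A} (adj : L ⊣ F)

instance : Category.{v} (FStable adj) :=
  inferInstanceAs (Category.{v} (CategoryTheory.Quotient (FactorsThroughRel (ImageSummand L))))

/-- The quotient functor. -/
def quotientFunctor : A ⥤ FStable adj :=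
  CategoryTheory.Quotient.functor (FactorsThroughRel (ImageSummand L))

noncomputable instance [F.Additive] : Preadditive (FStable adj) :=
  have : L.Additive := adj.left_adjoint_additive
  have : Congruence (FactorsThroughRel (ImageSummand L)) := congruence_factorsThroughRel L
  CategoryTheory.Quotient.preadditive (FactorsThroughRel (ImageSummand L))
    (fun _ _ _ _ _ _ h₁ h₂ => factorsThroughRel_of_add h₁ h₂ (by abel))

instance [F.Additive] : (quotientFunctor adj).Additive where
  map_add := rfl

instance [F.Additive] : HasZeroObject (FStable adj) :=
  (quotientFunctor adj).hasZeroObject_of_additive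

/-- Two morphisms become equal in the quotient if and only if they are related. -/
theorem quotientFunctor_map_eq_iff [F.Additive] {X Y : A} (f g : X ⟶ Y) :
    (quotientFunctor adj).map f = (quotientFunctor adj).map g ↔
      FactorsThroughRel (ImageSummand L) f g :=
  have : L.Additive := adj.left_adjoint_additive
  have : Congruence (FactorsThroughRel (ImageSummand L)) := congruence_factorsThroughRel L
  CategoryTheory.Quotient.functor_map_eq_iff _ f g

end FStable

/-- The class of `F`-split exact pairs: exact pairs of `A` that split upon applying `F`. -/
def FSplitExactPair (E : ExactStructure A) (F : A ⥤ B) [F.Additive] :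
    ObjectProperty (ShortComplex A) :=
  fun S => E.exactPair S ∧ Nonempty (S.map F).Splitting

/-- An `F`-split exact pair `X ⟶ I ⟶ T` in which `I` is `F`-injective, i.e. a direct summand of
an object in the image of `R`. -/
structure FInjectiveHull (E : ExactStructure A) (F : A ⥤ B) [F.Additive] (R : B ⥤ A) (X : A) where
  I : A
  T : A
  i : X ⟶ I
  p : I ⟶ T
  zero : i ≫ p = 0
  isFSplit : FSplitExactPair E F (ShortComplex.mk i p zero)
  isFInjective : ImageSummand R I

end

/-!
The `F`-split exact pairs form an exact structure on `A` (`ExactStructure.fSplit`): since `F` has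
adjoints on both sides, it preserves kernels, cokernels, pushouts and pullbacks, so an exact pair is
`F`-split as soon as `F` maps its inflation to a split monomorphism, or its deflation to a split
epimorphism. By adjunction, summands of objects `L Y` are projective and summands of objects `R Y`
are injective for this structure; by the triangle identities, the counit `L F X ⟶ X` is an `F`-split
deflation and the unit `X ⟶ R F X` is an `F`-split inflation. As both classes of summands coincide,
`A` is a Frobenius category and the quotient in question is its stable category
(`isFrobeniusQuotient_quotientFunctor`).

It remains to prove Happel's theorem that the stable category of a Frobenius category is
triangulated. This is done for any functor `Q` with the properties of the quotient functor
(`ExactStructure.IsFrobeniusQuotient`). The key fact is `map_third_eq_zero`: in a morphism from an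
exact pair to a *hull* `X ⟶ I ⟶ T`, the third component is stably determined by the first one. Hence
`T` depends functorially on `X` in the stable category (`suspMap`), and the triangle of an exact
pair is natural (`conn_naturality`). A hull of `X` being also a projective presentation of `T`, the
functor `X ↦ T` is an autoequivalence. Like every autoequivalence it is the shift by `1` of a shift
by the integers (`Functor.exists_hasShift`): the coherence problem disappears after passing to an
equivalent category, with formal powers of objects, on which the shift is strictly invertible.

For the axioms, every stable morphism is represented by an inflation (`exists_inflation`), and a
stably commutative square starting with an inflation can be made strictly commutative
(`exists_map_third`). A triangle is rotated forwards by pushing out a hull, backwards by pulling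
back a projective presentation. The octahedron on two inflations is a pushout diagram in `A`.
-/

/-! ### Integer shifts from autoequivalences -/

namespace CategoryTheory

/-- A fully faithful endofunctor which is bijective on objects has a strict inverse. -/
theorem Functor.exists_strict_inverse {D : Type u} [Category.{v} D] (S : D ⥤ D) [S.Full]
    [S.Faithful] (hS : Function.Bijective S.obj) :
    ∃ S' : D ⥤ D, S ⋙ S' = 𝟭 D ∧ S' ⋙ S = 𝟭 D := by
  let e : D ≃ D := Equiv.ofBijective S.obj hS
  have he (X : D) : S.obj (e.symm X) = X := e.apply_symm_apply X
  have he' (X : D) : e.symm (S.obj X) = X := e.symm_apply_apply X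
  let S' : D ⥤ D :=
    { obj X := e.symm X
      map {X Y} f := S.preimage (eqToHom (he X) ≫ f ≫ eqToHom (he Y).symm)
      map_id X := S.map_injective (by simp)
      map_comp f g := S.map_injective (by simp) }
  refine ⟨S', Functor.ext he' fun X Y f => S.map_injective ?_, Functor.ext he fun X Y f => ?_⟩
  · simp [S', eqToHom_map]
  · simp [S']

/-- The monoid of endofunctors of a category, with strict composition. -/
@[reducible]
def Functor.endMonoid (D : Type u) [Category.{v} D] : Monoid (D ⥤ D) where
  mul G H := G ⋙ H
  one := 𝟭 D
  mul_assoc _ _ _ := rfl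
  one_mul _ := rfl
  mul_one _ := rfl

/-- A strictly invertible endofunctor induces a shift by the integers: since all the coherence
isomorphisms are equalities of functors, there is nothing to check. -/
theorem Functor.exists_hasShift_of_strict_inverse {D : Type u} [Category.{v} D] (S S' : D ⥤ D)
    (h : S ⋙ S' = 𝟭 D) (h' : S' ⋙ S = 𝟭 D) :
    ∃ _ : HasShift D ℤ, shiftFunctor D (1 : ℤ) = S := by
  let _ : Monoid (D ⥤ D) := Functor.endMonoid D
  let U : (D ⥤ D)ˣ := ⟨S, S', h, h'⟩
  have h₀ : ((U ^ (0 : ℤ) : (D ⥤ D)ˣ) : D ⥤ D) = 𝟭 D := by rw [zpow_zero]; rfl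
  have hadd (n m : ℤ) : ((U ^ (n + m) : (D ⥤ D)ˣ) : D ⥤ D) =
      ((U ^ n : (D ⥤ D)ˣ) : D ⥤ D) ⋙ ((U ^ m : (D ⥤ D)ˣ) : D ⥤ D) := by
    rw [zpow_add]; rfl
  let c : ShiftMkCore D ℤ :=
    { F n := ((U ^ n : (D ⥤ D)ˣ) : D ⥤ D)
      zero := eqToIso h₀
      add n m := eqToIso (hadd n m)
      assoc_hom_app := by intros; simp [eqToHom_map]
      zero_add_hom_app := by intros; simp [eqToHom_map]
      add_zero_hom_app := by intros; simp }
  exact ⟨hasShiftMk D ℤ c, by change ((U ^ (1 : ℤ) : (D ⥤ D)ˣ) : D ⥤ D) = S; rw [zpow_one]⟩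

/-- A shift by the integers can be transported along an equivalence. -/
theorem Equivalence.exists_hasShift {C D : Type u} [Category.{v} C] [Category.{v} D]
    (e : C ≌ D) [HasShift D ℤ] :
    ∃ _ : HasShift C ℤ,
      Nonempty (shiftFunctor C (1 : ℤ) ≅ e.functor ⋙ shiftFunctor D (1 : ℤ) ⋙ e.inverse) :=
  ⟨e.fullyFaithfulFunctor.hasShift (fun n : ℤ => e.functor ⋙ shiftFunctor D n ⋙ e.inverse)
    (fun _ => Functor.associator _ _ _ ≪≫ Functor.isoWhiskerLeft _ (Functor.associator _ _ _) ≪≫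
      Functor.isoWhiskerLeft _ (Functor.isoWhiskerLeft _ e.counitIso) ≪≫
      Functor.isoWhiskerLeft _ (Functor.rightUnitor _)), ⟨Iso.refl _⟩⟩

section

variable {C : Type u} [Category.{v} C] (G : C ⥤ C) [G.IsEquivalence]

/-- The integral powers of an autoequivalence. -/
noncomputable def Functor.intPow : ℤ → C ⥤ C
  | Int.ofNat n => Nat.rec (𝟭 C) (fun _ H => H ⋙ G) n
  | Int.negSucc n => Nat.rec G.inv (fun _ H => H ⋙ G.inv) n

/-- The powers of an autoequivalence satisfy the expected recursion. -/
noncomputable def Functor.intPowSucc : ∀ n : ℤ, G.intPow n ⋙ G ≅ G.intPow (n + 1)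
  | Int.ofNat _ => Iso.refl _
  | Int.negSucc 0 => G.asEquivalence.counitIso
  | Int.negSucc (n + 1) =>
    (Functor.associator (G.intPow (Int.negSucc n)) G.inv G ≪≫
      Functor.isoWhiskerLeft _ G.asEquivalence.counitIso ≪≫ Functor.rightUnitor _ :
        (G.intPow (Int.negSucc n) ⋙ G.inv) ⋙ G ≅ G.intPow (Int.negSucc n))

/-- A category equivalent to `C` on which the autoequivalence `G` becomes strictly invertible.
Its objects are formal powers `Gⁿ X`, with `n : ℤ`. -/
structure Functor.FormalPower (_ : C ⥤ C) where
  /-- the exponent -/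
  exp : ℤ
  /-- the base object -/
  base : C

namespace Functor.FormalPower

variable {G}

/-- The object of `C` that a formal power stands for. -/
noncomputable def eval (X : G.FormalPower) : C := (G.intPow X.exp).obj X.base

noncomputable instance : Category.{v} G.FormalPower :=
  inferInstanceAs (Category.{v} (InducedCategory C eval))

variable (G)

/-- The evaluation functor, which is an equivalence. -/
noncomputable def evalFunctor : G.FormalPower ⥤ C := inducedFunctor eval

instance : (evalFunctor G).Full :=
  inferInstanceAs (inducedFunctor (eval : G.FormalPower → C)).Full
instance : (evalFunctor G).Faithful :=
  inferInstanceAs (inducedFunctor (eval : G.FormalPower → C)).Faithful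
instance : (evalFunctor G).EssSurj where
  mem_essImage X := ⟨⟨0, X⟩, ⟨Iso.refl X⟩⟩
instance : (evalFunctor G).IsEquivalence where

/-- Raising the exponent by one corresponds to `G` under evaluation. -/
noncomputable def evalSuccIso (X : G.FormalPower) :
    G.obj ((evalFunctor G).obj X) ≅ (evalFunctor G).obj ⟨X.exp + 1, X.base⟩ :=
  (G.intPowSucc X.exp).app X.base

/-- The functor raising the exponent of a formal power by one. -/
noncomputable def succ : G.FormalPower ⥤ G.FormalPower where
  obj X := ⟨X.exp + 1, X.base⟩
  map {X Y} f := (evalFunctor G).preimage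
    ((evalSuccIso G X).inv ≫ G.map ((evalFunctor G).map f) ≫ (evalSuccIso G Y).hom)
  map_id X := (evalFunctor G).map_injective (by simp)
  map_comp f g := (evalFunctor G).map_injective (by simp)

/-- Under evaluation, raising the exponent corresponds to `G`. -/
noncomputable def succIso : succ G ⋙ evalFunctor G ≅ evalFunctor G ⋙ G :=
  NatIso.ofComponents (fun X => (evalSuccIso G X).symm) (fun f => by simp [succ])

theorem succ_full_faithful : (succ G).Full ∧ (succ G).Faithful := by
  have : (succ G ⋙ evalFunctor G).Full := Full.of_iso (succIso G).symm
  have : (succ G ⋙ evalFunctor G).Faithful := Faithful.of_iso (succIso G).symm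
  exact ⟨Full.of_comp_faithful _ (evalFunctor G), Faithful.of_comp _ (evalFunctor G)⟩

theorem succ_obj_bijective : Function.Bijective (succ G).obj := by
  refine Function.bijective_iff_has_inverse.2 ⟨fun X => ⟨X.exp - 1, X.base⟩, ?_, ?_⟩
  · rintro ⟨n, X⟩
    simp [succ]
  · rintro ⟨n, X⟩
    simp [succ]

end Functor.FormalPower

/-- Any autoequivalence is, up to isomorphism, the shift by `1` of a shift by the integers. -/
theorem Functor.exists_hasShift :
    ∃ _ : HasShift C ℤ, Nonempty (shiftFunctor C (1 : ℤ) ≅ G) := by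
  obtain ⟨_, _⟩ := FormalPower.succ_full_faithful G
  obtain ⟨S', h, h'⟩ := (FormalPower.succ G).exists_strict_inverse
    (FormalPower.succ_obj_bijective G)
  obtain ⟨_, h₁⟩ := Functor.exists_hasShift_of_strict_inverse _ S' h h'
  let e := (FormalPower.evalFunctor G).asEquivalence.symm
  obtain ⟨inst, ⟨i⟩⟩ := e.exists_hasShift
  refine ⟨inst, ⟨i ≪≫ Functor.isoWhiskerLeft _ (Functor.isoWhiskerRight (eqToIso h₁) _ ≪≫
    FormalPower.succIso G) ≪≫ (Functor.associator _ _ _).symm ≪≫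
    Functor.isoWhiskerRight e.unitIso.symm G ≪≫ Functor.leftUnitor G⟩⟩

end

end CategoryTheory

/-! ### Inflations and deflations in exact categories -/

namespace ExactStructure

section

variable {A : Type u} [Category.{v} A] [Preadditive A] [HasZeroObject A] [HasBinaryBiproducts A]
  (E : ExactStructure A)

section

variable {E} {S : ShortComplex A}

theorem epi_g (hS : E.exactPair S) : Epi S.g := by
  obtain ⟨h⟩ := E.isCokernel S hS
  exact ⟨fun _ _ e => Cofork.IsColimit.hom_ext h e⟩

theorem mono_f (hS : E.exactPair S) : Mono S.f := by
  obtain ⟨h⟩ := E.isKernel S hS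
  exact ⟨fun _ _ e => Fork.IsLimit.hom_ext h e⟩

theorem exists_desc (hS : E.exactPair S) {W : A} (k : S.X₂ ⟶ W) (hk : S.f ≫ k = 0) :
    ∃ l : S.X₃ ⟶ W, S.g ≫ l = k := by
  obtain ⟨h⟩ := E.isCokernel S hS
  obtain ⟨l, hl⟩ := CokernelCofork.IsColimit.desc' h k hk
  exact ⟨l, hl⟩

theorem exists_lift (hS : E.exactPair S) {W : A} (k : W ⟶ S.X₂) (hk : k ≫ S.g = 0) :
    ∃ l : W ⟶ S.X₁, l ≫ S.f = k := by
  obtain ⟨h⟩ := E.isKernel S hS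
  obtain ⟨l, hl⟩ := KernelFork.IsLimit.lift' h k hk
  exact ⟨l, hl⟩

end

/-- An inflation followed by any of its cokernels is an exact pair. -/
theorem exactPair_of_isColimit {X Y Z : A} {f : X ⟶ Y} {g : Y ⟶ Z} (w : f ≫ g = 0)
    (hf : IsInflationFor E.exactPair f) (hg : IsColimit (CokernelCofork.ofπ g w)) :
    E.exactPair (ShortComplex.mk f g w) := by
  obtain ⟨Z', g', w', h⟩ := hf
  obtain ⟨h'⟩ := E.isCokernel _ h
  refine E.of_iso (S := ShortComplex.mk f g' w') (ShortComplex.isoMk (Iso.refl _) (Iso.refl _)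
    (IsColimit.coconePointUniqueUpToIso h' hg) (by simp) ?_) h
  simpa using (IsColimit.comp_coconePointUniqueUpToIso_hom h' hg WalkingParallelPair.one).symm

/-- A deflation preceded by any of its kernels is an exact pair. -/
theorem exactPair_of_isLimit {X Y Z : A} {f : X ⟶ Y} {g : Y ⟶ Z} (w : f ≫ g = 0)
    (hg : IsDeflationFor E.exactPair g) (hf : IsLimit (KernelFork.ofι f w)) :
    E.exactPair (ShortComplex.mk f g w) := by
  obtain ⟨X', f', w', h⟩ := hg
  obtain ⟨h'⟩ := E.isKernel _ h
  refine E.of_iso (S := ShortComplex.mk f' g w') (ShortComplex.isoMk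
    (IsLimit.conePointUniqueUpToIso h' hf) (Iso.refl _) (Iso.refl _) ?_ (by simp)) h
  simpa using IsLimit.conePointUniqueUpToIso_hom_comp h' hf WalkingParallelPair.zero

theorem isInflation_comp_iso {X Y Y' : A} {f : X ⟶ Y} (hf : IsInflationFor E.exactPair f)
    (e : Y ≅ Y') : IsInflationFor E.exactPair (f ≫ e.hom) := by
  obtain ⟨Z, g, w, h⟩ := hf
  exact ⟨Z, e.inv ≫ g, by simp [w], E.of_iso (S := ShortComplex.mk f g w)
    (ShortComplex.isoMk (Iso.refl _) e (Iso.refl _) (by simp) (by simp)) h⟩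

/-- In contrast with the axiom, every pushout of an inflation is an inflation. -/
theorem isInflation_of_isPushout {X Y X' Y' : A} {i : X ⟶ Y} {a : X ⟶ X'} {b : Y ⟶ Y'}
    {i' : X' ⟶ Y'} (h : IsPushout i a b i') (hi : IsInflationFor E.exactPair i) :
    IsInflationFor E.exactPair i' := by
  obtain ⟨Y'', b'', i'', h', hi''⟩ := E.pushout i a hi
  simpa using E.isInflation_comp_iso hi'' (h'.isoIsPushout _ _ h)

/-- The pushout of an exact pair along a morphism out of its first object. -/
theorem exists_pushout_exactPair {S : ShortComplex A} (hS : E.exactPair S) {X' : A}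
    (a : S.X₁ ⟶ X') :
    ∃ (Y' : A) (b : S.X₂ ⟶ Y') (i : X' ⟶ Y') (p : Y' ⟶ S.X₃) (w : i ≫ p = 0),
      IsPushout S.f a b i ∧ b ≫ p = S.g ∧ E.exactPair (ShortComplex.mk i p w) := by
  obtain ⟨Y', b, i, h, hi⟩ := E.pushout S.f a ⟨_, S.g, S.zero, hS⟩
  have hp₁ : b ≫ h.desc S.g 0 (by simp) = S.g := h.inl_desc _ _ _
  have hp₂ : i ≫ h.desc S.g 0 (by simp) = 0 := h.inr_desc _ _ _
  refine ⟨Y', b, i, h.desc S.g 0 (by simp), hp₂, h, hp₁, ?_⟩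
  refine E.exactPair_of_isColimit _ hi (Cofork.IsColimit.mk' _ fun s => ?_)
  have hs : i ≫ s.π = 0 := by simp
  have hs' : S.f ≫ b ≫ s.π = 0 := by rw [h.w_assoc, hs, comp_zero]
  have := epi_g hS
  refine ⟨(exists_desc hS _ hs').choose, h.hom_ext ?_ ?_, fun {m} hm => ?_⟩
  · simpa [reassoc_of% hp₁] using (exists_desc hS _ hs').choose_spec
  · simp [reassoc_of% hp₂, hs]
  · rw [← cancel_epi S.g, (exists_desc hS _ hs').choose_spec, ← hm]
    simp [reassoc_of% hp₁]

/-- The cokernel of a composite of two inflations is the pushout of the second one along the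
cokernel of the first one. -/
theorem exactPair_comp_of_isPushout {X Y Z U V : A} {f : X ⟶ Y} {q : Y ⟶ U} {w : f ≫ q = 0}
    (hf : E.exactPair (ShortComplex.mk f q w)) {g : Y ⟶ Z} (hg : IsInflationFor E.exactPair g)
    {b : Z ⟶ V} {i : U ⟶ V} (h : IsPushout g q b i) (w' : (f ≫ g) ≫ b = 0) :
    E.exactPair (ShortComplex.mk (f ≫ g) b w') := by
  have := epi_g hf
  refine E.exactPair_of_isColimit _ (E.inflation_comp _ _ ⟨_, q, w, hf⟩ hg)
    (Cofork.IsColimit.mk' _ fun c => ?_)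
  have hc : f ≫ g ≫ c.π = 0 := by
    rw [← Category.assoc]
    exact CokernelCofork.condition c
  have hl := (exists_desc hf (g ≫ c.π) hc).choose_spec
  refine ⟨h.desc c.π _ hl.symm, h.inl_desc _ _ _, fun {m} hm => h.hom_ext ?_ ?_⟩
  · rw [h.inl_desc]
    exact hm
  · rw [h.inr_desc, ← cancel_epi q, ← h.w_assoc]
    exact (congrArg (g ≫ ·) hm).trans hl.symm

/-- The pullback of an exact pair along a morphism into its third object. -/
theorem exists_pullback_exactPair {S : ShortComplex A} (hS : E.exactPair S) {Z' : A}
    (a : Z' ⟶ S.X₃) :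
    ∃ (Y' : A) (b : Y' ⟶ S.X₂) (p : Y' ⟶ Z') (i : S.X₁ ⟶ Y') (w : i ≫ p = 0),
      IsPullback b p S.g a ∧ i ≫ b = S.f ∧ E.exactPair (ShortComplex.mk i p w) := by
  obtain ⟨Y', b, p, h, hp⟩ := E.pullback S.g a ⟨_, S.f, S.zero, hS⟩
  have hi₁ : h.lift S.f 0 (by simp) ≫ b = S.f := h.lift_fst _ _ _
  have hi₂ : h.lift S.f 0 (by simp) ≫ p = 0 := h.lift_snd _ _ _
  refine ⟨Y', b, p, h.lift S.f 0 (by simp), hi₂, h, hi₁, ?_⟩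
  refine E.exactPair_of_isLimit _ hp (Fork.IsLimit.mk' _ fun s => ?_)
  have hs : s.ι ≫ p = 0 := by simp
  have hs' : (s.ι ≫ b) ≫ S.g = 0 := by rw [Category.assoc, h.w, reassoc_of% hs, zero_comp]
  have := mono_f hS
  refine ⟨(exists_lift hS _ hs').choose, h.hom_ext ?_ ?_, fun {m} hm => ?_⟩
  · simpa [hi₁] using (exists_lift hS _ hs').choose_spec
  · simp [hi₂, hs]
  · rw [← cancel_mono S.f, (exists_lift hS _ hs').choose_spec, ← hm]
    simp [hi₁]

theorem isInflation_biprod_inr (X Y : A) :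
    IsInflationFor E.exactPair (biprod.inr : Y ⟶ X ⊞ Y) := by
  have h₀ : IsInflationFor E.exactPair (0 : (0 : A) ⟶ X) := by
    obtain ⟨K, f, w, h⟩ := E.deflation_id X
    have hf : f = 0 := by simpa using w
    have := mono_f h
    have hK : IsZero K := by
      rw [IsZero.iff_id_eq_zero, ← cancel_mono f]
      simp [hf]
    exact ⟨_, 𝟙 X, by simp, E.of_iso (S := ShortComplex.mk f (𝟙 X) w)
      (ShortComplex.isoMk (hK.iso (isZero_zero A)) (Iso.refl _) (Iso.refl _)
        (by simp [hf]) (by simp)) h⟩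
  exact E.isInflation_of_isPushout (IsPushout.of_has_biproduct X Y) h₀

/-- If `i` is an inflation then so is `(u, i)` for any `u`: this is how an arbitrary morphism `u`
is replaced by an inflation. -/
theorem isInflation_biprod_lift {X Y I : A} (u : X ⟶ Y) {i : X ⟶ I}
    (hi : IsInflationFor E.exactPair i) : IsInflationFor E.exactPair (biprod.lift u i) := by
  have h₁ : IsInflationFor E.exactPair (biprod.map (𝟙 Y) i) := by
    refine E.isInflation_of_isPushout (i := i) (a := biprod.inr) (b := biprod.inr) ?_ hi
    refine ⟨⟨by simp⟩, ⟨PushoutCocone.IsColimit.mk _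
      (fun s => biprod.desc (biprod.inl ≫ s.inr) s.inl) ?_ ?_ ?_⟩⟩
    · intro s
      simp
    · intro s
      ext
      · simp
      · simpa using s.condition
    · intro s m h₁ h₂
      ext
      · simp [← h₂]
      · simpa using h₁
  -- the automorphism of `Y ⊞ X` with matrix `(1, u; 0, 1)`
  let e : Y ⊞ X ≅ Y ⊞ X :=
    { hom := biprod.desc biprod.inl (biprod.lift u (𝟙 X))
      inv := biprod.desc biprod.inl (biprod.lift (-u) (𝟙 X))
      hom_inv_id := by ext <;> simp
      inv_hom_id := by ext <;> simp }
  have h₂ := E.inflation_comp _ _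
    (E.isInflation_comp_iso (E.isInflation_biprod_inr Y X) e) h₁
  have h₃ : (biprod.inr ≫ e.hom) ≫ biprod.map (𝟙 Y) i = biprod.lift u i := by
    ext <;> simp [e]
  rwa [h₃] at h₂

end

/-! ### The exact structure of `F`-split exact pairs -/

section

variable {A : Type u} [Category.{v} A] [Preadditive A] [HasZeroObject A] [HasBinaryBiproducts A]
  {B : Type u'} [Category.{v'} B] [Preadditive B]
  (E : ExactStructure A) {F : A ⥤ B} [F.Additive] {L R : B ⥤ A}

variable {E} in
/-- A functor with a right adjoint preserves the cokernel in an exact pair, so it suffices to have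
a retraction in order to get a splitting. -/
theorem fSplitExactPair_of_retraction (adjR : F ⊣ R) {S : ShortComplex A} (hS : E.exactPair S)
    (r : F.obj S.X₂ ⟶ F.obj S.X₁) (hr : F.map S.f ≫ r = 𝟙 _) : FSplitExactPair E F S := by
  have := epi_g hS
  have : F.IsLeftAdjoint := adjR.isLeftAdjoint
  have : R.Additive := adjR.right_adjoint_additive
  obtain ⟨s, hs⟩ : ∃ s : F.obj S.X₃ ⟶ F.obj S.X₂, F.map S.g ≫ s = 𝟙 _ - r ≫ F.map S.f := by
    obtain ⟨l, hl⟩ := exists_desc hS (adjR.homEquiv _ _ (𝟙 _ - r ≫ F.map S.f)) (by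
      rw [← adjR.homEquiv_naturality_left, Preadditive.comp_sub, reassoc_of% hr]
      simp [adjR.homEquiv_unit])
    refine ⟨(adjR.homEquiv _ _).symm l, (adjR.homEquiv _ _).injective ?_⟩
    rw [adjR.homEquiv_naturality_left, Equiv.apply_symm_apply, hl]
  have h₀ : F.map S.f ≫ F.map S.g = 0 := by rw [← F.map_comp, S.zero, F.map_zero]
  refine ⟨hS, ⟨{ r := r, s := s, f_r := hr, s_g := ?_, id := ?_ }⟩⟩
  · change s ≫ F.map S.g = 𝟙 _
    rw [← cancel_epi (F.map S.g), reassoc_of% hs, Preadditive.sub_comp, Category.assoc, h₀]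
    simp
  · change r ≫ F.map S.f + F.map S.g ≫ s = 𝟙 _
    rw [hs]
    abel

variable {E} in
/-- A functor with a left adjoint preserves the kernel in an exact pair, so it suffices to have
a section in order to get a splitting. -/
theorem fSplitExactPair_of_section (adjL : L ⊣ F) {S : ShortComplex A} (hS : E.exactPair S)
    (s : F.obj S.X₃ ⟶ F.obj S.X₂) (hs : s ≫ F.map S.g = 𝟙 _) : FSplitExactPair E F S := by
  have := mono_f hS
  have : F.IsRightAdjoint := adjL.isRightAdjoint
  have : L.Additive := adjL.left_adjoint_additive
  obtain ⟨r, hr⟩ : ∃ r : F.obj S.X₂ ⟶ F.obj S.X₁, r ≫ F.map S.f = 𝟙 _ - F.map S.g ≫ s := by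
    obtain ⟨l, hl⟩ := exists_lift hS ((adjL.homEquiv _ _).symm (𝟙 _ - F.map S.g ≫ s)) (by
      rw [← adjL.homEquiv_naturality_right_symm, Preadditive.sub_comp, Category.assoc, hs]
      simp [adjL.homEquiv_counit])
    refine ⟨adjL.homEquiv _ _ l, (adjL.homEquiv _ _).symm.injective ?_⟩
    rw [adjL.homEquiv_naturality_right_symm, Equiv.symm_apply_apply, hl]
  have h₀ : F.map S.f ≫ F.map S.g = 0 := by rw [← F.map_comp, S.zero, F.map_zero]
  refine ⟨hS, ⟨{ r := r, s := s, f_r := ?_, s_g := hs, id := ?_ }⟩⟩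
  · change F.map S.f ≫ r = 𝟙 _
    rw [← cancel_mono (F.map S.f), Category.assoc, hr, Preadditive.comp_sub, reassoc_of% h₀]
    simp
  · change r ≫ F.map S.f + F.map S.g ≫ s = 𝟙 _
    rw [hr]
    abel

theorem isInflationFor_fSplit_iff (adjR : F ⊣ R) {X Y : A} (f : X ⟶ Y) :
    IsInflationFor (FSplitExactPair E F) f ↔
      IsInflationFor E.exactPair f ∧ ∃ r, F.map f ≫ r = 𝟙 (F.obj X) := by
  constructor
  · rintro ⟨Z, g, w, h, ⟨σ⟩⟩
    exact ⟨⟨Z, g, w, h⟩, σ.r, σ.f_r⟩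
  · rintro ⟨⟨Z, g, w, h⟩, r, hr⟩
    exact ⟨Z, g, w, fSplitExactPair_of_retraction adjR h r hr⟩

theorem isDeflationFor_fSplit_iff (adjL : L ⊣ F) {Y Z : A} (g : Y ⟶ Z) :
    IsDeflationFor (FSplitExactPair E F) g ↔
      IsDeflationFor E.exactPair g ∧ ∃ s, s ≫ F.map g = 𝟙 (F.obj Z) := by
  constructor
  · rintro ⟨X, f, w, h, ⟨σ⟩⟩
    exact ⟨⟨X, f, w, h⟩, σ.s, σ.s_g⟩
  · rintro ⟨⟨X, f, w, h⟩, s, hs⟩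
    exact ⟨X, f, w, fSplitExactPair_of_section adjL h s hs⟩

/-- If `F` has adjoints on both sides, the `F`-split exact pairs form an exact structure. -/
def fSplit (adjL : L ⊣ F) (adjR : F ⊣ R) : ExactStructure A where
  exactPair := FSplitExactPair E F
  of_iso := by
    rintro S S' e ⟨h, ⟨σ⟩⟩
    exact ⟨E.of_iso e h, ⟨σ.ofIso (F.mapShortComplex.mapIso e)⟩⟩
  isKernel S hS := E.isKernel S hS.1
  isCokernel S hS := E.isCokernel S hS.1
  inflation_id X := (E.isInflationFor_fSplit_iff adjR _).2 ⟨E.inflation_id X, 𝟙 _, by simp⟩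
  deflation_id X := (E.isDeflationFor_fSplit_iff adjL _).2 ⟨E.deflation_id X, 𝟙 _, by simp⟩
  inflation_comp f g hf hg := by
    obtain ⟨hf, r, hr⟩ := (E.isInflationFor_fSplit_iff adjR _).1 hf
    obtain ⟨hg, r', hr'⟩ := (E.isInflationFor_fSplit_iff adjR _).1 hg
    exact (E.isInflationFor_fSplit_iff adjR _).2
      ⟨E.inflation_comp f g hf hg, r' ≫ r, by simp [reassoc_of% hr', hr]⟩
  deflation_comp f g hf hg := by
    obtain ⟨hf, s, hs⟩ := (E.isDeflationFor_fSplit_iff adjL _).1 hf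
    obtain ⟨hg, s', hs'⟩ := (E.isDeflationFor_fSplit_iff adjL _).1 hg
    exact (E.isDeflationFor_fSplit_iff adjL _).2
      ⟨E.deflation_comp f g hf hg, s' ≫ s, by simp [reassoc_of% hs, hs']⟩
  pushout i a hi := by
    have := adjR.leftAdjoint_preservesColimits
    obtain ⟨hi, r, hr⟩ := (E.isInflationFor_fSplit_iff adjR _).1 hi
    obtain ⟨Y', b, i', h, hi'⟩ := E.pushout i a hi
    refine ⟨Y', b, i', h, (E.isInflationFor_fSplit_iff adjR _).2 ⟨hi', ?_⟩⟩
    exact ⟨(h.map F).desc (r ≫ F.map a) (𝟙 _) (by simp [reassoc_of% hr]), (h.map F).inr_desc _ _ _⟩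
  pullback p a hp := by
    have := adjL.rightAdjoint_preservesLimits
    obtain ⟨hp, s, hs⟩ := (E.isDeflationFor_fSplit_iff adjL _).1 hp
    obtain ⟨Y', b, p', h, hp'⟩ := E.pullback p a hp
    refine ⟨Y', b, p', h, (E.isDeflationFor_fSplit_iff adjL _).2 ⟨hp', ?_⟩⟩
    exact ⟨(h.map F).lift (F.map a ≫ s) (𝟙 _) (by simp [hs]), (h.map F).lift_snd _ _ _⟩

end

end ExactStructure

/-! ### Stable quotients of Frobenius categories and their suspension -/

namespace ExactStructure

section

variable {A : Type u} [Category.{v} A] [Preadditive A] [HasZeroObject A] [HasBinaryBiproducts A]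

/-- An exact pair `X ⟶ I ⟶ T` whose middle term belongs to `P`. If `E` is a Frobenius category and
`P` consists of its projective-injective objects, `T` is a suspension of `X` in the stable
category. -/
structure Hull (E : ExactStructure A) (P : ObjectProperty A) (X : A) where
  /-- the middle term -/
  I : A
  /-- the suspension -/
  T : A
  /-- the inflation -/
  i : X ⟶ I
  /-- the deflation -/
  p : I ⟶ T
  zero : i ≫ p = 0
  exact : E.exactPair (ShortComplex.mk i p zero)
  mem : P I

variable {C : Type u'} [Category.{v'} C] [Preadditive C]

/-- `Q : A ⥤ C` behaves like the stable quotient of a Frobenius category: the objects of `P` are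
projective and injective for `E`, there are enough of them on both sides, and the morphisms
killed by `Q` are those factoring through `P`. -/
structure IsFrobeniusQuotient (E : ExactStructure A) (P : ObjectProperty A) (Q : A ⥤ C) :
    Prop where
  projective : ∀ {S : ShortComplex A}, E.exactPair S → ∀ {W : A}, P W →
    ∀ f : W ⟶ S.X₃, ∃ g : W ⟶ S.X₂, g ≫ S.g = f
  injective : ∀ {S : ShortComplex A}, E.exactPair S → ∀ {W : A}, P W →
    ∀ f : S.X₁ ⟶ W, ∃ g : S.X₂ ⟶ W, S.f ≫ g = f
  enough_injectives : ∀ X : A, Nonempty (Hull E P X)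
  enough_projectives : ∀ T : A, ∃ (K W : A) (j : K ⟶ W) (q : W ⟶ T) (w : j ≫ q = 0),
    E.exactPair (ShortComplex.mk j q w) ∧ P W
  map_eq_zero_iff : ∀ {X Y : A} (f : X ⟶ Y),
    Q.map f = 0 ↔ ∃ (W : A) (_ : P W) (a : X ⟶ W) (b : W ⟶ Y), a ≫ b = f

namespace IsFrobeniusQuotient

variable {E : ExactStructure A} {P : ObjectProperty A} {Q : A ⥤ C}

theorem map_comp_eq_zero (h : IsFrobeniusQuotient E P Q) {X W Y : A} (hW : P W) (a : X ⟶ W)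
    (b : W ⟶ Y) : Q.map (a ≫ b) = 0 :=
  (h.map_eq_zero_iff _).2 ⟨W, hW, a, b, rfl⟩

/-- The key fact on which well-definedness and naturality of everything below rest: in a morphism
from an exact pair to a hull, if the first component is stably zero then so is the third. -/
theorem map_third_eq_zero (h : IsFrobeniusQuotient E P Q) {S : ShortComplex A}
    (hS : E.exactPair S) {X' : A} (H' : Hull E P X') (a : S.X₁ ⟶ X') (b : S.X₂ ⟶ H'.I)
    (c : S.X₃ ⟶ H'.T) (hab : S.f ≫ b = a ≫ H'.i) (hbc : S.g ≫ c = b ≫ H'.p)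
    (ha : Q.map a = 0) : Q.map c = 0 := by
  have := epi_g hS
  obtain ⟨W, hW, α, β, rfl⟩ := (h.map_eq_zero_iff a).1 ha
  obtain ⟨α', hα'⟩ := h.injective hS hW α
  obtain ⟨k, hk⟩ := exists_desc hS (b - α' ≫ β ≫ H'.i) (by
    rw [Preadditive.comp_sub, hab, reassoc_of% hα']
    simp)
  have hc : c = k ≫ H'.p := by
    rw [← cancel_epi S.g, hbc, reassoc_of% hk]
    simp [H'.zero]
  rw [hc]
  exact h.map_comp_eq_zero H'.mem _ _

/-- A morphism from the first object of an exact pair to `X'` extends to a morphism from the exact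
pair to any given hull of `X'`. -/
theorem exists_conn (h : IsFrobeniusQuotient E P Q) {S : ShortComplex A}
    (hS : E.exactPair S) {X' : A} (H' : Hull E P X') (a : S.X₁ ⟶ X') :
    ∃ (s : S.X₂ ⟶ H'.I) (w : S.X₃ ⟶ H'.T), S.f ≫ s = a ≫ H'.i ∧ S.g ≫ w = s ≫ H'.p := by
  obtain ⟨s, hs⟩ := h.injective hS H'.mem (a ≫ H'.i)
  obtain ⟨w, hw⟩ := exists_desc hS (s ≫ H'.p) (by rw [reassoc_of% hs, H'.zero, comp_zero])
  exact ⟨s, w, hs, hw⟩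

theorem exists_conn_hull (h : IsFrobeniusQuotient E P Q) {S : ShortComplex A}
    (hS : E.exactPair S) (H : Hull E P S.X₁) :
    ∃ (s : S.X₂ ⟶ H.I) (w : S.X₃ ⟶ H.T), S.f ≫ s = H.i ∧ S.g ≫ w = s ≫ H.p := by
  simpa using h.exists_conn hS H (𝟙 _)

variable [Q.Full]

theorem exists_suspMap (h : IsFrobeniusQuotient E P Q) {X X' : A} (H : Hull E P X)
    (H' : Hull E P X') (φ : Q.obj X ⟶ Q.obj X') :
    ∃ (k : H.T ⟶ H'.T) (f : X ⟶ X') (g : H.I ⟶ H'.I),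
      Q.map f = φ ∧ H.i ≫ g = f ≫ H'.i ∧ H.p ≫ k = g ≫ H'.p := by
  obtain ⟨g, k, hg, hk⟩ := h.exists_conn H.exact H' (Q.preimage φ)
  exact ⟨k, Q.preimage φ, g, by simp, hg, hk⟩

/-- The action of the suspension on a morphism of the stable category, computed with respect to
arbitrary hulls of its source and target. -/
noncomputable def suspMap (h : IsFrobeniusQuotient E P Q) {X X' : A} (H : Hull E P X)
    (H' : Hull E P X') (φ : Q.obj X ⟶ Q.obj X') : Q.obj H.T ⟶ Q.obj H'.T :=
  Q.map (h.exists_suspMap H H' φ).choose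

variable [Q.Additive]

theorem suspMap_map (h : IsFrobeniusQuotient E P Q) {X X' : A} (H : Hull E P X)
    (H' : Hull E P X') (f : X ⟶ X') (g : H.I ⟶ H'.I) (k : H.T ⟶ H'.T)
    (hg : H.i ≫ g = f ≫ H'.i) (hk : H.p ≫ k = g ≫ H'.p) :
    h.suspMap H H' (Q.map f) = Q.map k := by
  obtain ⟨f', g', hf', hg', hk'⟩ := (h.exists_suspMap H H' (Q.map f)).choose_spec
  rw [suspMap, ← sub_eq_zero, ← Q.map_sub]
  refine h.map_third_eq_zero H.exact H' (f' - f) (g' - g) _ ?_ ?_ ?_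
  · simp [hg, hg']
  · rw [Preadditive.comp_sub, Preadditive.sub_comp, hk]
    exact congrArg (· - g ≫ H'.p) hk'
  · simp [hf']

theorem suspMap_id (h : IsFrobeniusQuotient E P Q) {X : A} (H : Hull E P X) :
    h.suspMap H H (𝟙 _) = 𝟙 _ := by
  simpa using h.suspMap_map H H (𝟙 _) (𝟙 _) (𝟙 _) (by simp) (by simp)

theorem suspMap_comp (h : IsFrobeniusQuotient E P Q) {X X' X'' : A} (H : Hull E P X)
    (H' : Hull E P X') (H'' : Hull E P X'') (φ : Q.obj X ⟶ Q.obj X') (ψ : Q.obj X' ⟶ Q.obj X'') :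
    h.suspMap H H'' (φ ≫ ψ) = h.suspMap H H' φ ≫ h.suspMap H' H'' ψ := by
  obtain ⟨k, f, g, rfl, hg, hk⟩ := h.exists_suspMap H H' φ
  obtain ⟨k', f', g', rfl, hg', hk'⟩ := h.exists_suspMap H' H'' ψ
  rw [h.suspMap_map H H' f g k hg hk, h.suspMap_map H' H'' f' g' k' hg' hk', ← Q.map_comp,
    ← Q.map_comp]
  exact h.suspMap_map H H'' _ (g ≫ g') _ (by simp [reassoc_of% hg, hg'])
    (by simp [reassoc_of% hk, hk'])

theorem suspMap_bijective (h : IsFrobeniusQuotient E P Q) {X X' : A} (H : Hull E P X)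
    (H' : Hull E P X') : Function.Bijective (h.suspMap H H') := by
  have := epi_g H.exact
  have := mono_f H'.exact
  constructor
  · intro φ ψ hφψ
    obtain ⟨k, f, g, rfl, hg, hk⟩ := h.exists_suspMap H H' φ
    obtain ⟨k', f', g', rfl, hg', hk'⟩ := h.exists_suspMap H H' ψ
    rw [h.suspMap_map H H' f g k hg hk, h.suspMap_map H H' f' g' k' hg' hk', ← sub_eq_zero,
      ← Q.map_sub] at hφψ
    -- the third component factors through `P`, hence lifts along the deflation of `H'`
    obtain ⟨W, hW, a, b, hab⟩ := (h.map_eq_zero_iff _).1 hφψ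
    obtain ⟨b', hb'⟩ := h.projective H'.exact hW b
    dsimp at hb' b'
    obtain ⟨l, hl⟩ := exists_lift H'.exact ((g - g') - H.p ≫ a ≫ b') (by
      simp [hb', hab, ← hk, ← hk'])
    dsimp at hl l
    rw [← sub_eq_zero, ← Q.map_sub, show f - f' = H.i ≫ l by
      rw [← cancel_mono H'.i, Category.assoc, hl, Preadditive.comp_sub, reassoc_of% H.zero]
      simp [hg, hg']]
    exact h.map_comp_eq_zero H.mem _ _
  · intro χ
    obtain ⟨k, rfl⟩ := Q.map_surjective χ
    obtain ⟨g, hg⟩ := h.projective H'.exact H.mem (H.p ≫ k)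
    dsimp at g hg
    obtain ⟨f, hf⟩ := exists_lift H'.exact (H.i ≫ g) (by
      simp [hg, reassoc_of% H.zero])
    exact ⟨Q.map f, h.suspMap_map H H' f g k hf.symm hg.symm⟩

/-- Any two suspensions of stably isomorphic objects are stably isomorphic. -/
noncomputable def suspIso (h : IsFrobeniusQuotient E P Q) {X X' : A} (H : Hull E P X)
    (H' : Hull E P X') (e : Q.obj X ≅ Q.obj X') : Q.obj H.T ≅ Q.obj H'.T where
  hom := h.suspMap H H' e.hom
  inv := h.suspMap H' H e.inv
  hom_inv_id := by rw [← suspMap_comp, e.hom_inv_id, suspMap_id]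
  inv_hom_id := by rw [← suspMap_comp, e.inv_hom_id, suspMap_id]

/-- A chosen hull. -/
noncomputable def hull (h : IsFrobeniusQuotient E P Q) (X : A) : Hull E P X :=
  (h.enough_injectives X).some

variable [Q.EssSurj]

/-- The suspension functor of the stable category, for the chosen hulls. -/
noncomputable def susp (h : IsFrobeniusQuotient E P Q) : C ⥤ C where
  obj c := Q.obj (h.hull (Q.objPreimage c)).T
  map {c d} φ := h.suspMap _ _ ((Q.objObjPreimageIso c).hom ≫ φ ≫ (Q.objObjPreimageIso d).inv)
  map_id c := by simp [suspMap_id]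
  map_comp φ ψ := by simp [← suspMap_comp]

/-- The suspension is computed by any hull. -/
noncomputable def suspObjIso (h : IsFrobeniusQuotient E P Q) {X : A} (H : Hull E P X) :
    h.susp.obj (Q.obj X) ≅ Q.obj H.T :=
  h.suspIso _ H (Q.objObjPreimageIso (Q.obj X))

theorem suspObjIso_naturality (h : IsFrobeniusQuotient E P Q) {X X' : A} (H : Hull E P X)
    (H' : Hull E P X') (φ : Q.obj X ⟶ Q.obj X') :
    h.susp.map φ ≫ (h.suspObjIso H').hom = (h.suspObjIso H).hom ≫ h.suspMap H H' φ := by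
  simp [susp, suspObjIso, suspIso, ← suspMap_comp]

theorem susp_isEquivalence (h : IsFrobeniusQuotient E P Q) : h.susp.IsEquivalence where
  faithful := ⟨fun {c d} φ ψ hφψ => by
    simpa [cancel_epi, cancel_mono] using (h.suspMap_bijective _ _).1 hφψ⟩
  full := ⟨fun {c d} χ => by
    obtain ⟨φ, hφ⟩ := (h.suspMap_bijective _ _).2 χ
    exact ⟨(Q.objObjPreimageIso c).inv ≫ φ ≫ (Q.objObjPreimageIso d).hom, by
      dsimp only [susp]
      simpa using hφ⟩⟩
  essSurj := ⟨fun d => by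
    obtain ⟨K, W, j, q, w, hjq, hW⟩ := h.enough_projectives (Q.objPreimage d)
    exact ⟨Q.obj K, ⟨h.suspObjIso ⟨W, _, j, q, w, hjq, hW⟩ ≪≫ Q.objObjPreimageIso d⟩⟩⟩

/-- The stable category has a shift by the integers computed by hulls. -/
theorem exists_hasShift (h : IsFrobeniusQuotient E P Q) :
    ∃ (_ : HasShift C ℤ) (θ : ∀ {X : A} (H : Hull E P X), (Q.obj X)⟦(1 : ℤ)⟧ ≅ Q.obj H.T),
      ∀ {X X' : A} (H : Hull E P X) (H' : Hull E P X') (φ : Q.obj X ⟶ Q.obj X'),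
        φ⟦(1 : ℤ)⟧' ≫ (θ H').hom = (θ H).hom ≫ h.suspMap H H' φ := by
  have := h.susp_isEquivalence
  obtain ⟨inst, ⟨e⟩⟩ := h.susp.exists_hasShift
  refine ⟨inst, fun H => e.app _ ≪≫ h.suspObjIso H, fun H H' φ => ?_⟩
  simpa using h.suspObjIso_naturality H H' φ

end IsFrobeniusQuotient

end

end ExactStructure

/-! ### The triangulated structure of a stable quotient -/

namespace ExactStructure

variable {A : Type u} [Category.{v} A] [Preadditive A] [HasZeroObject A] [HasBinaryBiproducts A]
  {C : Type u'} [Category.{v'} C] [Preadditive C] {E : ExactStructure A} {P : ObjectProperty A}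
  {Q : A ⥤ C} [Q.Full]

namespace IsFrobeniusQuotient

/-- Every morphism of the stable category is, up to isomorphism, the image of an inflation with
the same source. -/
theorem exists_inflation [Q.Additive] (h : IsFrobeniusQuotient E P Q) {X Y : A}
    (φ : Q.obj X ⟶ Q.obj Y) :
    ∃ (M Z : A) (u : X ⟶ M) (v : M ⟶ Z) (w : u ≫ v = 0) (e : Q.obj M ≅ Q.obj Y),
      E.exactPair (ShortComplex.mk u v w) ∧ Q.map u ≫ e.hom = φ := by
  obtain ⟨H⟩ := h.enough_injectives X
  obtain ⟨Z, v, w, hS⟩ := E.isInflation_biprod_lift (Q.preimage φ) ⟨_, H.p, H.zero, H.exact⟩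
  refine ⟨_, Z, _, v, w, ⟨Q.map biprod.fst, Q.map biprod.inl, ?_, ?_⟩, hS, ?_⟩
  · rw [← Q.map_comp, ← Q.map_id, ← biprod.total, Q.map_add, h.map_comp_eq_zero H.mem, add_zero]
  · rw [← Q.map_comp, biprod.inl_fst, Q.map_id]
  · rw [← Q.map_comp, biprod.lift_fst, Q.map_preimage]

variable [HasShift C ℤ]

/-- The data of an identification of the shift of the stable category with the suspension computed
by hulls. -/
structure ShiftData (h : IsFrobeniusQuotient E P Q) where
  /-- the comparison isomorphism -/
  iso : ∀ {X : A} (H : Hull E P X), (Q.obj X)⟦(1 : ℤ)⟧ ≅ Q.obj H.T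
  naturality : ∀ {X X' : A} (H : Hull E P X) (H' : Hull E P X') (φ : Q.obj X ⟶ Q.obj X'),
    φ⟦(1 : ℤ)⟧' ≫ (iso H').hom = (iso H).hom ≫ h.suspMap H H' φ

namespace ShiftData

variable {h : IsFrobeniusQuotient E P Q} (θ : h.ShiftData)

/-- The triangle defined by an exact pair and a map from it to a hull of its first object. -/
def triangle (S : ShortComplex A) (H : Hull E P S.X₁) (w : S.X₃ ⟶ H.T) : Triangle C :=
  Triangle.mk (Q.map S.f) (Q.map S.g) (Q.map w ≫ (θ.iso H).inv)

/-- The triangles isomorphic to one coming from an exact pair. -/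
def distinguished : Set (Triangle C) := fun D =>
  ∃ S : ShortComplex A, E.exactPair S ∧
    ∃ (H : Hull E P S.X₁) (s : S.X₂ ⟶ H.I) (w : S.X₃ ⟶ H.T),
      S.f ≫ s = H.i ∧ S.g ≫ w = s ≫ H.p ∧ Nonempty (D ≅ θ.triangle S H w)

theorem inv_naturality {X X' : A} (H : Hull E P X) (H' : Hull E P X') (φ : Q.obj X ⟶ Q.obj X') :
    (θ.iso H).inv ≫ φ⟦(1 : ℤ)⟧' = h.suspMap H H' φ ≫ (θ.iso H').inv := by
  rw [Iso.inv_comp_eq, ← Category.assoc, Iso.eq_comp_inv, θ.naturality]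

theorem isomorphic_distinguished (D : Triangle C) (hD : D ∈ θ.distinguished) (D' : Triangle C)
    (e : D' ≅ D) : D' ∈ θ.distinguished := by
  obtain ⟨S, hS, H, s, w, hs, hw, ⟨e'⟩⟩ := hD
  exact ⟨S, hS, H, s, w, hs, hw, ⟨e ≪≫ e'⟩⟩

theorem triangle_distinguished {S : ShortComplex A} (hS : E.exactPair S) (H : Hull E P S.X₁)
    {s : S.X₂ ⟶ H.I} {w : S.X₃ ⟶ H.T} (hs : S.f ≫ s = H.i) (hw : S.g ≫ w = s ≫ H.p) :
    θ.triangle S H w ∈ θ.distinguished :=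
  ⟨S, hS, H, s, w, hs, hw, ⟨Iso.refl _⟩⟩

/-- An isomorphism with the triangle of an exact pair, given by its components. -/
theorem mem_distinguished {S : ShortComplex A} (hS : E.exactPair S) (H : Hull E P S.X₁)
    {s : S.X₂ ⟶ H.I} {w : S.X₃ ⟶ H.T} (hs : S.f ≫ s = H.i) (hw : S.g ≫ w = s ≫ H.p)
    {X Y Z : C} {f : X ⟶ Y} {g : Y ⟶ Z} {k : Z ⟶ X⟦(1 : ℤ)⟧} (e₁ : X ≅ Q.obj S.X₁)
    (e₂ : Y ≅ Q.obj S.X₂) (e₃ : Z ≅ Q.obj S.X₃) (h₁ : f ≫ e₂.hom = e₁.hom ≫ Q.map S.f)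
    (h₂ : g ≫ e₃.hom = e₂.hom ≫ Q.map S.g)
    (h₃ : k ≫ e₁.hom⟦(1 : ℤ)⟧' = e₃.hom ≫ Q.map w ≫ (θ.iso H).inv) :
    Triangle.mk f g k ∈ θ.distinguished :=
  ⟨S, hS, H, s, w, hs, hw, ⟨Triangle.isoMk _ _ e₁ e₂ e₃ h₁ h₂ h₃⟩⟩

/-- The components of a distinguished triangle. -/
theorem exists_of_mem_distinguished {D : Triangle C} (hD : D ∈ θ.distinguished) :
    ∃ S : ShortComplex A, E.exactPair S ∧
      ∃ (H : Hull E P S.X₁) (s : S.X₂ ⟶ H.I) (w : S.X₃ ⟶ H.T),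
        S.f ≫ s = H.i ∧ S.g ≫ w = s ≫ H.p ∧
        ∃ (e₁ : D.obj₁ ≅ Q.obj S.X₁) (e₂ : D.obj₂ ≅ Q.obj S.X₂) (e₃ : D.obj₃ ≅ Q.obj S.X₃),
          D.mor₁ ≫ e₂.hom = e₁.hom ≫ Q.map S.f ∧ D.mor₂ ≫ e₃.hom = e₂.hom ≫ Q.map S.g ∧
          D.mor₃ ≫ e₁.hom⟦(1 : ℤ)⟧' = e₃.hom ≫ Q.map w ≫ (θ.iso H).inv := by
  obtain ⟨S, hS, H, s, w, hs, hw, ⟨e⟩⟩ := hD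
  exact ⟨S, hS, H, s, w, hs, hw, Triangle.π₁.mapIso e, Triangle.π₂.mapIso e,
    Triangle.π₃.mapIso e, e.hom.comm₁, e.hom.comm₂, e.hom.comm₃⟩

variable [Q.Additive]

/-- A morphism of exact pairs in `A` induces a morphism between the triangles which they define,
whatever the choices of hulls and of maps to the hulls. -/
theorem conn_naturality {S S' : ShortComplex A} (hS : E.exactPair S)
    (H : Hull E P S.X₁) {s : S.X₂ ⟶ H.I} {w : S.X₃ ⟶ H.T} (hs : S.f ≫ s = H.i)
    (hw : S.g ≫ w = s ≫ H.p) (H' : Hull E P S'.X₁) {s' : S'.X₂ ⟶ H'.I} {w' : S'.X₃ ⟶ H'.T}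
    (hs' : S'.f ≫ s' = H'.i) (hw' : S'.g ≫ w' = s' ≫ H'.p)
    (a : S.X₁ ⟶ S'.X₁) (b : S.X₂ ⟶ S'.X₂) (c : S.X₃ ⟶ S'.X₃) (hab : S.f ≫ b = a ≫ S'.f)
    (hbc : S.g ≫ c = b ≫ S'.g) :
    (Q.map w ≫ (θ.iso H).inv) ≫ (Q.map a)⟦(1 : ℤ)⟧' = Q.map c ≫ Q.map w' ≫ (θ.iso H').inv := by
  obtain ⟨g, k, hg, hk⟩ := h.exists_conn H.exact H' a
  dsimp at hg hk g k
  rw [Category.assoc, inv_naturality θ H H', h.suspMap_map H H' a g k hg hk, ← Q.map_comp_assoc,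
    ← Q.map_comp_assoc]
  congr 1
  rw [← sub_eq_zero, ← Q.map_sub]
  refine h.map_third_eq_zero hS H' 0 (s ≫ g - b ≫ s') _ ?_ ?_ (by simp)
  · simp [reassoc_of% hs, reassoc_of% hab, hs', hg]
  · simp [reassoc_of% hw, reassoc_of% hbc, hw', hk]

theorem contractible_distinguished [Q.EssSurj] [HasZeroObject C] (X : C) :
    contractibleTriangle X ∈ θ.distinguished := by
  obtain ⟨Z, g, w₀, hS⟩ := E.inflation_id (Q.objPreimage X)
  have := epi_g hS
  have hZ : IsZero (Q.obj Z) := by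
    have hg : g = 0 := by simpa using w₀
    refine Q.map_isZero ((IsZero.iff_id_eq_zero _).2 ?_)
    rw [← cancel_epi g]
    simp [hg]
  obtain ⟨H⟩ := h.enough_injectives (Q.objPreimage X)
  obtain ⟨s, w, hs, hw⟩ := h.exists_conn_hull hS H
  exact θ.mem_distinguished hS H hs hw (Q.objObjPreimageIso X).symm (Q.objObjPreimageIso X).symm
    ((isZero_zero C).iso hZ) (by simp) (hZ.eq_of_tgt _ _) ((isZero_zero C).eq_of_src _ _)

theorem distinguished_cocone_triangle [Q.EssSurj] {X Y : C} (f : X ⟶ Y) :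
    ∃ (Z : C) (g : Y ⟶ Z) (k : Z ⟶ X⟦(1 : ℤ)⟧), Triangle.mk f g k ∈ θ.distinguished := by
  let eX := Q.objObjPreimageIso X
  let eY := Q.objObjPreimageIso Y
  obtain ⟨M, Z, u, v, w₀, e, hS, hu⟩ := h.exists_inflation (eX.hom ≫ f ≫ eY.inv)
  obtain ⟨H⟩ := h.enough_injectives (Q.objPreimage X)
  obtain ⟨s, w, hs, hw⟩ := h.exists_conn_hull hS H
  refine ⟨Q.obj Z, (eY.inv ≫ e.inv) ≫ Q.map v, (Q.map w ≫ (θ.iso H).inv) ≫ eX.hom⟦(1 : ℤ)⟧',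
    θ.mem_distinguished hS H hs hw eX.symm (eY.symm ≪≫ e.symm) (Iso.refl _) ?_ ?_ ?_⟩
  · have : Q.map u = eX.hom ≫ f ≫ eY.inv ≫ e.inv := by
      rw [← Category.assoc, ← Category.assoc, Iso.eq_comp_inv, hu, Category.assoc]
    simp [this]
  · simp
  · simp [← Functor.map_comp]

/-- Completion of a commutative square between triangles defined by exact pairs: the square can be
modified by a morphism factoring through `P` so as to commute strictly. -/
theorem exists_map_third {S S' : ShortComplex A} (hS : E.exactPair S)
    (H : Hull E P S.X₁) {s : S.X₂ ⟶ H.I} {w : S.X₃ ⟶ H.T} (hs : S.f ≫ s = H.i)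
    (hw : S.g ≫ w = s ≫ H.p) (H' : Hull E P S'.X₁) {s' : S'.X₂ ⟶ H'.I} {w' : S'.X₃ ⟶ H'.T}
    (hs' : S'.f ≫ s' = H'.i) (hw' : S'.g ≫ w' = s' ≫ H'.p)
    (a : Q.obj S.X₁ ⟶ Q.obj S'.X₁) (b : Q.obj S.X₂ ⟶ Q.obj S'.X₂)
    (hab : Q.map S.f ≫ b = a ≫ Q.map S'.f) :
    ∃ c : Q.obj S.X₃ ⟶ Q.obj S'.X₃, Q.map S.g ≫ c = b ≫ Q.map S'.g ∧
      (Q.map w ≫ (θ.iso H).inv) ≫ a⟦(1 : ℤ)⟧' = c ≫ Q.map w' ≫ (θ.iso H').inv := by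
  obtain ⟨a, rfl⟩ := Q.map_surjective a
  obtain ⟨b, rfl⟩ := Q.map_surjective b
  rw [← Q.map_comp, ← Q.map_comp, ← sub_eq_zero, ← Q.map_sub, h.map_eq_zero_iff] at hab
  obtain ⟨W, hW, α, β, hαβ⟩ := hab
  obtain ⟨α', hα'⟩ := h.injective hS hW α
  have hab' : S.f ≫ (b - α' ≫ β) = a ≫ S'.f := by
    rw [Preadditive.comp_sub, reassoc_of% hα', hαβ]
    abel
  obtain ⟨c, hc⟩ := exists_desc hS ((b - α' ≫ β) ≫ S'.g) (by
    rw [reassoc_of% hab', S'.zero, comp_zero])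
  refine ⟨Q.map c, ?_, θ.conn_naturality hS H hs hw H' hs' hw' a _ c hab' hc⟩
  rw [← Q.map_comp, hc, Q.map_comp, Q.map_sub, h.map_comp_eq_zero hW, sub_zero]

theorem complete_distinguished_triangle_morphism (T₁ T₂ : Triangle C)
    (h₁ : T₁ ∈ θ.distinguished) (h₂ : T₂ ∈ θ.distinguished) (a : T₁.obj₁ ⟶ T₂.obj₁)
    (b : T₁.obj₂ ⟶ T₂.obj₂) (hab : T₁.mor₁ ≫ b = a ≫ T₂.mor₁) :
    ∃ c : T₁.obj₃ ⟶ T₂.obj₃, T₁.mor₂ ≫ c = b ≫ T₂.mor₂ ∧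
      T₁.mor₃ ≫ a⟦(1 : ℤ)⟧' = c ≫ T₂.mor₃ := by
  obtain ⟨S, hS, H, s, w, hs, hw, e₁, e₂, e₃, c₁, c₂, c₃⟩ := θ.exists_of_mem_distinguished h₁
  obtain ⟨S', hS', H', s', w', hs', hw', e₁', e₂', e₃', c₁', c₂', c₃'⟩ :=
    θ.exists_of_mem_distinguished h₂
  obtain ⟨c, hc, hc'⟩ := θ.exists_map_third hS H hs hw H' hs' hw'
    (e₁.inv ≫ a ≫ e₁'.hom) (e₂.inv ≫ b ≫ e₂'.hom) (by
      rw [← cancel_epi e₁.hom, ← reassoc_of% c₁]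
      simp [reassoc_of% hab, c₁'])
  refine ⟨e₃.hom ≫ c ≫ e₃'.inv, ?_, ?_⟩
  · rw [reassoc_of% c₂, reassoc_of% hc, ← cancel_mono e₃'.hom]
    simp [c₂']
  · rw [← cancel_mono (e₁'.hom⟦(1 : ℤ)⟧'), Category.assoc, Category.assoc, Category.assoc, c₃',
      Category.assoc,
      Iso.inv_hom_id_assoc, ← hc', ← Category.assoc e₃.hom, ← c₃]
    simp [← Functor.map_comp]

/-- The rotation of a triangle defined by an exact pair `X ⟶ Y ⟶ Z` is defined by the exact pair
`Y ⟶ M ⟶ T` obtained by pushing out a hull `X ⟶ I ⟶ T`. Here `M` is stably isomorphic to `Z`,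
since the pushout `I ⟶ M` of `X ⟶ Y` splits. -/
theorem rotate_triangle_distinguished {S : ShortComplex A} (hS : E.exactPair S)
    (H : Hull E P S.X₁) {s : S.X₂ ⟶ H.I} {w : S.X₃ ⟶ H.T} (hs : S.f ≫ s = H.i)
    (hw : S.g ≫ w = s ≫ H.p) : (θ.triangle S H w).rotate ∈ θ.distinguished := by
  have := epi_g hS
  obtain ⟨M, b, j, π, hjπ, hM, hbπ, hS'⟩ := E.exists_pushout_exactPair H.exact S.f
  dsimp at b j π hM hbπ hS'
  obtain ⟨q, hbq, hjq⟩ : ∃ q : M ⟶ S.X₃, b ≫ q = 0 ∧ j ≫ q = S.g :=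
    ⟨hM.desc 0 S.g (by simp), hM.inl_desc _ _ _, hM.inr_desc _ _ _⟩
  -- `r` and `t` exhibit `M` as the direct sum of `H.I` and `S.X₃`
  obtain ⟨r, hbr, hjr⟩ : ∃ r : M ⟶ H.I, b ≫ r = 𝟙 _ ∧ j ≫ r = s :=
    ⟨hM.desc (𝟙 _) s (by simp [hs]), hM.inl_desc _ _ _, hM.inr_desc _ _ _⟩
  obtain ⟨t, ht⟩ : ∃ t : S.X₃ ⟶ M, q ≫ t = 𝟙 _ - r ≫ b := by
    obtain ⟨t, ht⟩ := exists_desc hS (j ≫ (𝟙 _ - r ≫ b)) (by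
      rw [← hM.w_assoc, Preadditive.comp_sub, reassoc_of% hbr]
      simp)
    refine ⟨t, hM.hom_ext ?_ ?_⟩
    · rw [reassoc_of% hbq, Preadditive.comp_sub, reassoc_of% hbr]
      simp
    · rw [reassoc_of% hjq, ht]
  have htq : t ≫ q = 𝟙 _ := by
    rw [← cancel_epi S.g, ← hjq, Category.assoc, reassoc_of% ht, Preadditive.sub_comp,
      Category.assoc, hbq]
    simp
  -- hence stably `π` is `-w`
  have hqw : q ≫ w + π = r ≫ H.p := by
    refine hM.hom_ext ?_ ?_
    · rw [Preadditive.comp_add, reassoc_of% hbq, hbπ, reassoc_of% hbr]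
      simp
    · rw [Preadditive.comp_add, reassoc_of% hjq, hjπ, reassoc_of% hjr, hw, add_zero]
  let eM : Q.obj S.X₃ ≅ Q.obj M :=
    { hom := Q.map t
      inv := Q.map q
      hom_inv_id := by rw [← Q.map_comp, htq, Q.map_id]
      inv_hom_id := by
        rw [← Q.map_comp, ht, Q.map_sub, h.map_comp_eq_zero H.mem, sub_zero, Q.map_id] }
  have hπ : Q.map t ≫ Q.map π = - Q.map w := by
    have h₁ : t ≫ π = t ≫ r ≫ H.p - w := by
      rw [← hqw, Preadditive.comp_add, reassoc_of% htq]
      abel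
    rw [← Q.map_comp, h₁, Q.map_sub, ← Category.assoc, h.map_comp_eq_zero H.mem, zero_sub]
  obtain ⟨H'⟩ := h.enough_injectives S.X₂
  obtain ⟨s', w', hs', hw'⟩ := h.exists_conn_hull hS' H'
  have hw'' := θ.conn_naturality (S' := ShortComplex.mk j π hjπ) H.exact H
    (s := 𝟙 _) (w := 𝟙 _) (by simp) (by simp) H' hs' hw' S.f b (𝟙 _) hM.w (by simp [hbπ])
  simp only [Q.map_id, Category.id_comp] at hw''
  -- both signs, `π = -w` and the one of the rotated triangle, are absorbed by `eT`
  let eT : (Q.obj S.X₁)⟦(1 : ℤ)⟧ ≅ Q.obj H.T :=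
    { hom := - (θ.iso H).hom
      inv := - (θ.iso H).inv }
  refine θ.mem_distinguished hS' H' hs' hw' (Iso.refl _) eM eT ?_ ?_ ?_
  · have : S.g ≫ t = j - s ≫ b := by
      rw [← hjq, Category.assoc, ht, Preadditive.comp_sub, reassoc_of% hjr, Category.comp_id]
    change Q.map S.g ≫ Q.map t = 𝟙 _ ≫ Q.map j
    rw [← Q.map_comp, this, Q.map_sub, h.map_comp_eq_zero H.mem, sub_zero, Category.id_comp]
  · change (Q.map w ≫ (θ.iso H).inv) ≫ (- (θ.iso H).hom) = Q.map t ≫ Q.map π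
    simp [hπ]
  · change (- (Q.map S.f)⟦(1 : ℤ)⟧') ≫ (𝟙 (Q.obj S.X₂))⟦(1 : ℤ)⟧' =
      (- (θ.iso H).hom) ≫ Q.map w' ≫ (θ.iso H').inv
    simp [← hw'']

variable [∀ n : ℤ, (shiftFunctor C n).Additive]

/-- A triangle is distinguished if its rotation is. If the rotation is given by an exact pair
`A ⟶ B ⟶ W`, then the triangle itself is given by the exact pair `K ⟶ M ⟶ B` obtained by pulling
back a projective presentation `K ⟶ V ⟶ W`. -/
theorem distinguished_of_rotate [Q.EssSurj] (D : Triangle C) (hD : D.rotate ∈ θ.distinguished) :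
    D ∈ θ.distinguished := by
  obtain ⟨S, hS, H, s, w, hs, hw, e₁, e₂, e₃, he₁, he₂, he₃⟩ := θ.exists_of_mem_distinguished hD
  change D.obj₂ ≅ _ at e₁
  change D.obj₃ ≅ _ at e₂
  change D.obj₁⟦(1 : ℤ)⟧ ≅ _ at e₃
  change D.mor₂ ≫ e₂.hom = e₁.hom ≫ Q.map S.f at he₁
  change D.mor₃ ≫ e₃.hom = e₂.hom ≫ Q.map S.g at he₂
  change (- D.mor₁⟦(1 : ℤ)⟧') ≫ e₁.hom⟦(1 : ℤ)⟧' = e₃.hom ≫ Q.map w ≫ (θ.iso H).inv at he₃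
  have := mono_f hS
  obtain ⟨K, V, j, π, hjπ, hV, hVP⟩ := h.enough_projectives S.X₃
  let HK : Hull E P K := ⟨V, S.X₃, j, π, hjπ, hV, hVP⟩
  obtain ⟨M, b, p, i, hip, hM, hib, hS'⟩ := E.exists_pullback_exactPair hV S.g
  dsimp at b p i hM hib hS'
  obtain ⟨a, hab, hap⟩ : ∃ a : S.X₁ ⟶ M, a ≫ b = 0 ∧ a ≫ p = S.f :=
    ⟨hM.lift 0 S.f (by simp), hM.lift_fst _ _ _, hM.lift_snd _ _ _⟩
  -- lifting `π` along `S.g` splits `b`, so that `M` is the direct sum of `S.X₁` and `V`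
  obtain ⟨l₀, hl₀⟩ := h.projective hS hVP π
  obtain ⟨l, hlb, hlp⟩ : ∃ l : V ⟶ M, l ≫ b = 𝟙 _ ∧ l ≫ p = l₀ :=
    ⟨hM.lift (𝟙 _) l₀ (by simp [hl₀]), hM.lift_fst _ _ _, hM.lift_snd _ _ _⟩
  obtain ⟨r, hr⟩ : ∃ r : M ⟶ S.X₁, r ≫ a = 𝟙 _ - b ≫ l := by
    obtain ⟨r, hr⟩ := exists_lift hS ((𝟙 _ - b ≫ l) ≫ p) (by
      rw [Category.assoc, ← hM.w, Preadditive.sub_comp, Category.assoc, reassoc_of% hlb]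
      simp)
    refine ⟨r, hM.hom_ext ?_ ?_⟩
    · rw [Category.assoc, hab, Preadditive.sub_comp, Category.assoc, hlb]
      simp
    · rw [Category.assoc, hap, hr]
  have har : a ≫ r = 𝟙 _ := by
    rw [← cancel_mono S.f, ← hap, Category.assoc, reassoc_of% hr, Preadditive.sub_comp,
      Preadditive.comp_sub, Category.assoc, reassoc_of% hab]
    simp
  let eM : Q.obj S.X₁ ≅ Q.obj M :=
    { hom := Q.map a
      inv := Q.map r
      hom_inv_id := by rw [← Q.map_comp, har, Q.map_id]
      inv_hom_id := by
        rw [← Q.map_comp, hr, Q.map_sub, h.map_comp_eq_zero hVP, sub_zero, Q.map_id] }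
  -- the morphism `(-(i ≫ r), l₀, 𝟙)` from `K ⟶ V ⟶ S.X₃` to `S` shows that stably `w` is
  -- the shift of `-(i ≫ r)`
  have hconn := θ.conn_naturality hV HK (s := 𝟙 _) (w := 𝟙 _) (by simp [HK]) (by simp [HK])
    H hs hw (-(i ≫ r)) l₀ (𝟙 _) (by
      dsimp
      rw [← hap, Preadditive.neg_comp, Category.assoc, reassoc_of% hr, Preadditive.sub_comp,
        Preadditive.comp_sub, Category.id_comp, hip, Category.assoc, hlp, reassoc_of% hib]
      simp) (by simp [hl₀])
  simp only [Q.map_id, Category.id_comp] at hconn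
  let ψ : D.obj₁ ≅ Q.obj K := (shiftFunctor C (1 : ℤ)).preimageIso (e₃ ≪≫ (θ.iso HK).symm)
  have hψ : ψ.hom⟦(1 : ℤ)⟧' = e₃.hom ≫ (θ.iso HK).inv := by simp [ψ]
  refine θ.mem_distinguished hS' HK (s := b) (w := S.g) hib hM.w.symm ψ (e₁ ≪≫ eM) e₂ ?_ ?_ ?_
  · change D.mor₁ ≫ e₁.hom ≫ eM.hom = ψ.hom ≫ Q.map i
    rw [← Category.assoc, ← Iso.eq_comp_inv]
    change D.mor₁ ≫ e₁.hom = (ψ.hom ≫ Q.map i) ≫ Q.map r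
    rw [Category.assoc, ← Q.map_comp]
    apply (shiftFunctor C (1 : ℤ)).map_injective
    rw [Functor.map_comp, Functor.map_comp, hψ, ← neg_inj, ← Preadditive.neg_comp, he₃, ← hconn]
    simp
  · change D.mor₂ ≫ e₂.hom = (e₁.hom ≫ Q.map a) ≫ Q.map p
    rw [he₁, Category.assoc, ← Q.map_comp, hap]
  · change D.mor₃ ≫ ψ.hom⟦(1 : ℤ)⟧' = e₂.hom ≫ Q.map S.g ≫ (θ.iso HK).inv
    rw [hψ, reassoc_of% he₂]

theorem rotate_distinguished_triangle [Q.EssSurj] (D : Triangle C) :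
    D ∈ θ.distinguished ↔ D.rotate ∈ θ.distinguished := by
  refine ⟨?_, θ.distinguished_of_rotate D⟩
  rintro ⟨S, hS, H, s, w, hs, hw, ⟨e⟩⟩
  exact θ.isomorphic_distinguished _ (θ.rotate_triangle_distinguished hS H hs hw) _
    ((rotate C).mapIso e)

/-- The stable quotient of a Frobenius category is pretriangulated. -/
@[reducible]
def pretriangulated [Q.EssSurj] [HasZeroObject C] : Pretriangulated C where
  distinguishedTriangles := θ.distinguished
  isomorphic_distinguished := θ.isomorphic_distinguished
  contractible_distinguished := θ.contractible_distinguished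
  distinguished_cocone_triangle := θ.distinguished_cocone_triangle
  rotate_distinguished_triangle := θ.rotate_distinguished_triangle
  complete_distinguished_triangle_morphism := θ.complete_distinguished_triangle_morphism

/-- The octahedral axiom: for composable inflations `u₁₂` and `u₂₃`, the cokernels of `u₁₂`,
`u₁₂ ≫ u₂₃` and `u₂₃` form an exact pair, which is a pushout of the exact pair defined by `u₂₃`. -/
theorem isTriangulated [Q.EssSurj] [HasZeroObject C] :
    letI := θ.pretriangulated
    IsTriangulated C := by
  let _ := θ.pretriangulated
  refine IsTriangulated.mk' fun X₁ X₂ X₃ f g => ?_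
  let d₁ := Q.objObjPreimageIso X₁
  let d₂ := Q.objObjPreimageIso X₂
  let d₃ := Q.objObjPreimageIso X₃
  obtain ⟨A₂, Z₁₂, u₁₂, v₁₂, z₁₂, e₂, h₁₂, hu₁₂⟩ := h.exists_inflation (d₁.hom ≫ f ≫ d₂.inv)
  obtain ⟨A₃, Z₂₃, u₂₃, v₂₃, z₂₃, e₃, h₂₃, hu₂₃⟩ :=
    h.exists_inflation (e₂.hom ≫ d₂.hom ≫ g ≫ d₃.inv)
  obtain ⟨Z₁₃, v₁₃, i, p, hip, hZ, hvp, h'⟩ := E.exists_pushout_exactPair h₂₃ v₁₂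
  dsimp at v₁₃ i p hZ hvp h'
  have z₁₃ : (u₁₂ ≫ u₂₃) ≫ v₁₃ = 0 := by rw [Category.assoc, hZ.w, reassoc_of% z₁₂, zero_comp]
  have h₁₃ := E.exactPair_comp_of_isPushout h₁₂ ⟨_, v₂₃, z₂₃, h₂₃⟩ hZ z₁₃
  obtain ⟨H₁⟩ := h.enough_injectives (Q.objPreimage X₁)
  obtain ⟨H₂⟩ := h.enough_injectives A₂
  obtain ⟨H₃⟩ := h.enough_injectives Z₁₂
  obtain ⟨s₁₂, w₁₂, hs₁₂, hw₁₂⟩ := h.exists_conn_hull h₁₂ H₁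
  obtain ⟨s₂₃, w₂₃, hs₂₃, hw₂₃⟩ := h.exists_conn_hull h₂₃ H₂
  obtain ⟨s₁₃, w₁₃, hs₁₃, hw₁₃⟩ := h.exists_conn_hull h₁₃ H₁
  obtain ⟨s', w', hs', hw'⟩ := h.exists_conn_hull h' H₃
  have c₂ := θ.conn_naturality (S' := ShortComplex.mk (u₁₂ ≫ u₂₃) v₁₃ z₁₃) h₁₂ H₁ hs₁₂ hw₁₂
    H₁ hs₁₃ hw₁₃ (𝟙 _) u₂₃ i (by simp) hZ.w.symm
  have c₄ := θ.conn_naturality (S' := ShortComplex.mk u₂₃ v₂₃ z₂₃) h₁₃ H₁ hs₁₃ hw₁₃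
    H₂ hs₂₃ hw₂₃ u₁₂ (𝟙 _) p (by simp) (by simp [hvp])
  have c₅ := θ.conn_naturality (S' := ShortComplex.mk i p hip) h₂₃ H₂ hs₂₃ hw₂₃
    H₃ hs' hw' v₁₂ v₁₃ (𝟙 _) hZ.w (by simp [hvp])
  have t₁₃ := θ.triangle_distinguished h₁₃ H₁ hs₁₃ hw₁₃
  have t' := θ.triangle_distinguished h' H₃ hs' hw'
  simp only [triangle, Q.map_comp u₁₂ u₂₃] at t₁₃
  simp only [Q.map_id, CategoryTheory.Functor.map_id, Category.comp_id, Category.id_comp] at c₂ c₅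
  refine ⟨_, _, _, _, _, _, Q.map u₁₂, Q.map u₂₃, d₁.symm, d₂.symm ≪≫ e₂.symm,
    d₃.symm ≪≫ e₃.symm, ?_, ?_, Q.map v₁₂, Q.map w₁₂ ≫ (θ.iso H₁).inv,
    θ.triangle_distinguished h₁₂ H₁ hs₁₂ hw₁₂, Q.map v₂₃, Q.map w₂₃ ≫ (θ.iso H₂).inv,
    θ.triangle_distinguished h₂₃ H₂ hs₂₃ hw₂₃, Q.map v₁₃, Q.map w₁₃ ≫ (θ.iso H₁).inv, t₁₃,
    ⟨⟨Q.map i, Q.map p, ?_, c₂.symm, ?_, c₄, ?_⟩⟩⟩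
  · rw [← cancel_mono e₂.hom, ← cancel_epi d₁.hom]
    simp [hu₁₂]
  · rw [← cancel_mono e₃.hom, ← cancel_epi d₂.hom, ← cancel_epi e₂.hom]
    simp [hu₂₃]
  · rw [← Q.map_comp, ← Q.map_comp, hZ.w]
  · rw [← Q.map_comp, hvp]
  · rw [c₅]
    exact t'

end ShiftData

end IsFrobeniusQuotient

end ExactStructure

/-! ### The stable category of a functor with adjoints -/

section

variable {A : Type u} [Category.{v} A] [Preadditive A] [HasZeroObject A] [HasBinaryBiproducts A]
  {B : Type u'} [Category.{v'} B] [Preadditive B]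

/-- Direct summands of objects `L.obj Y` are projective with respect to `F`-split exact pairs. -/
theorem exists_lift_of_imageSummand {E : ExactStructure A} {F : A ⥤ B} [F.Additive] {L : B ⥤ A}
    (adj : L ⊣ F) {S : ShortComplex A} (hS : FSplitExactPair E F S) {W : A}
    (hW : ImageSummand L W) (f : W ⟶ S.X₃) : ∃ g : W ⟶ S.X₂, g ≫ S.g = f := by
  obtain ⟨_, ⟨σ⟩⟩ := hS
  obtain ⟨Y, V, ⟨e⟩⟩ := hW
  obtain ⟨s, hs⟩ : ∃ s : F.obj S.X₃ ⟶ F.obj S.X₂, s ≫ F.map S.g = 𝟙 _ := ⟨σ.s, σ.s_g⟩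
  refine ⟨biprod.inl ≫ e.inv ≫
    (adj.homEquiv _ _).symm (adj.homEquiv _ _ (e.hom ≫ biprod.fst ≫ f) ≫ s), ?_⟩
  rw [Category.assoc, Category.assoc, ← adj.homEquiv_naturality_right_symm, Category.assoc, hs,
    Category.comp_id, Equiv.symm_apply_apply]
  simp

/-- Direct summands of objects `R.obj Y` are injective with respect to `F`-split exact pairs. -/
theorem exists_extension_of_imageSummand {E : ExactStructure A} {F : A ⥤ B} [F.Additive]
    {R : B ⥤ A} (adj : F ⊣ R) {S : ShortComplex A} (hS : FSplitExactPair E F S) {W : A}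
    (hW : ImageSummand R W) (f : S.X₁ ⟶ W) : ∃ g : S.X₂ ⟶ W, S.f ≫ g = f := by
  obtain ⟨_, ⟨σ⟩⟩ := hS
  obtain ⟨Y, V, ⟨e⟩⟩ := hW
  obtain ⟨r, hr⟩ : ∃ r : F.obj S.X₂ ⟶ F.obj S.X₁, F.map S.f ≫ r = 𝟙 _ := ⟨σ.r, σ.f_r⟩
  refine ⟨adj.homEquiv _ _ (r ≫ (adj.homEquiv _ _).symm (f ≫ biprod.inl ≫ e.inv)) ≫
    e.hom ≫ biprod.fst, ?_⟩
  rw [← Category.assoc, ← adj.homEquiv_naturality_left, reassoc_of% hr, Equiv.apply_symm_apply]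
  simp

variable [HasZeroObject B] [HasBinaryBiproducts B]

namespace FStable

variable {F : A ⥤ B} {L : B ⥤ A} (adj : L ⊣ F)

instance : (quotientFunctor adj).Full :=
  inferInstanceAs (CategoryTheory.Quotient.functor (FactorsThroughRel (ImageSummand L))).Full

instance : (quotientFunctor adj).EssSurj :=
  inferInstanceAs (CategoryTheory.Quotient.functor (FactorsThroughRel (ImageSummand L))).EssSurj

end FStable

/-- For the exact structure of `F`-split exact pairs, `A` is a Frobenius category whose
projective-injective objects are the direct summands of objects `L.obj Y`. -/
theorem isFrobeniusQuotient_quotientFunctor (E : ExactStructure A) (F : A ⥤ B) [F.Additive]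
    {L R : B ⥤ A} (adjL : L ⊣ F) (adjR : F ⊣ R)
    (hcounit : ∀ X : A, IsDeflationFor E.exactPair (adjL.counit.app X))
    (hunit : ∀ X : A, IsInflationFor E.exactPair (adjR.unit.app X))
    (hLR : ImageSummand L = ImageSummand R) :
    (E.fSplit adjL adjR).IsFrobeniusQuotient (ImageSummand L)
      (FStable.quotientFunctor adjL) where
  projective hS _ hW f := exists_lift_of_imageSummand adjL hS hW f
  injective hS _ hW f := exists_extension_of_imageSummand adjR hS (hLR ▸ hW) f
  enough_injectives X := by
    -- `F` maps the unit to a split monomorphism by the triangle identity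
    obtain ⟨T, p, w, h⟩ := (E.isInflationFor_fSplit_iff adjR _).2
      ⟨hunit X, _, adjR.left_triangle_components X⟩
    exact ⟨⟨_, T, _, p, w, h, hLR ▸ imageSummand_obj R (F.obj X)⟩⟩
  enough_projectives T := by
    obtain ⟨K, j, w, h⟩ := (E.isDeflationFor_fSplit_iff adjL _).2
      ⟨hcounit T, _, adjL.right_triangle_components T⟩
    exact ⟨K, _, j, _, w, h, imageSummand_obj L (F.obj T)⟩
  map_eq_zero_iff {X Y} f := by
    rw [← (FStable.quotientFunctor adjL).map_zero X Y, FStable.quotientFunctor_map_eq_iff]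
    simp [FactorsThroughRel]

end

/-- An essentially surjective additive functor transports binary biproducts to its target. -/
theorem hasBinaryBiproducts_of_essSurj {A : Type u} [Category.{v} A] [Preadditive A]
    [HasBinaryBiproducts A] {C : Type u'} [Category.{v'} C] [Preadditive C]
    (Q : A ⥤ C) [Q.Additive] [Q.EssSurj] : HasBinaryBiproducts C where
  has_binary_biproduct X Y :=
    hasBinaryBiproduct_of_total
      { pt := Q.obj (Q.objPreimage X ⊞ Q.objPreimage Y)
        fst := Q.map biprod.fst ≫ (Q.objObjPreimageIso X).hom
        snd := Q.map biprod.snd ≫ (Q.objObjPreimageIso Y).hom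
        inl := (Q.objObjPreimageIso X).inv ≫ Q.map biprod.inl
        inr := (Q.objObjPreimageIso Y).inv ≫ Q.map biprod.inr
        inl_fst := by simp [← Q.map_comp_assoc]
        inl_snd := by simp [← Q.map_comp_assoc]
        inr_fst := by simp [← Q.map_comp_assoc]
        inr_snd := by simp [← Q.map_comp_assoc] }
      (by
        simp only [Category.assoc, Iso.hom_inv_id_assoc]
        rw [← Q.map_comp, ← Q.map_comp, ← Q.map_add, biprod.total, Q.map_id])

/-- Shift functors are additive, being equivalences between categories with biproducts. -/
theorem shiftFunctor_additive {C : Type u} [Category.{v} C] [Preadditive C] [HasZeroObject C]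
    [HasBinaryBiproducts C] [HasShift C ℤ] (n : ℤ) : (shiftFunctor C n).Additive :=
  Functor.additive_of_preserves_binary_products _

theorem mainTheorem4
    {A : Type u} [Category.{v} A] [Preadditive A] [HasZeroObject A] [HasBinaryBiproducts A]
    {B : Type u'} [Category.{v'} B] [Preadditive B] [HasZeroObject B] [HasBinaryBiproducts B]
    (EA : ExactStructure A) (_EB : ExactStructure B)
    (F : A ⥤ B) [F.Additive] (L R : B ⥤ A) (adjL : L ⊣ F) (adjR : F ⊣ R)
    (hcounit : ∀ X : A, IsDeflationFor EA.exactPair (adjL.counit.app X))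
    (hunit : ∀ X : A, IsInflationFor EA.exactPair (adjR.unit.app X))
    (hLR : ImageSummand L = ImageSummand R) :
    ∃ (_ : HasShift (FStable adjL) ℤ)
      (_ : ∀ n : ℤ, (shiftFunctor (FStable adjL) n).Additive)
      (_ : Pretriangulated (FStable adjL)),
      IsTriangulated (FStable adjL) ∧
      -- the shift of `X` is computed by any `F`-split exact pair `X ⟶ I ⟶ T`, `I` `F`-injective
      ∃ θ : ∀ {X : A} (H : FInjectiveHull EA F R X),
          ((FStable.quotientFunctor adjL).obj X)⟦(1 : ℤ)⟧ ≅
            (FStable.quotientFunctor adjL).obj H.T,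
        -- naturally in `X` and in the chosen exact pair
        (∀ {X X' : A} (H : FInjectiveHull EA F R X) (H' : FInjectiveHull EA F R X')
          (f : X ⟶ X') (g : H.I ⟶ H'.I) (h : H.T ⟶ H'.T),
          H.i ≫ g = f ≫ H'.i → H.p ≫ h = g ≫ H'.p →
            ((FStable.quotientFunctor adjL).map f)⟦(1 : ℤ)⟧' ≫ (θ H').hom =
              (θ H).hom ≫ (FStable.quotientFunctor adjL).map h) ∧
        -- the distinguished triangles are, up to isomorphism, those coming from an `F`-split
        -- exact pair `S` by mapping it to an exact pair `S.X₁ ⟶ I ⟶ T` as above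
        ∀ D : Triangle (FStable adjL),
          D ∈ distTriang (FStable adjL) ↔
            ∃ S : ShortComplex A, FSplitExactPair EA F S ∧
              ∃ (H : FInjectiveHull EA F R S.X₁) (s : S.X₂ ⟶ H.I) (w : S.X₃ ⟶ H.T),
                S.f ≫ s = H.i ∧ S.g ≫ w = s ≫ H.p ∧
                Nonempty (D ≅ Triangle.mk ((FStable.quotientFunctor adjL).map S.f)
                  ((FStable.quotientFunctor adjL).map S.g)
                  ((FStable.quotientFunctor adjL).map w ≫ (θ H).inv)) := by
  have h := isFrobeniusQuotient_quotientFunctor EA F adjL adjR hcounit hunit hLR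
  obtain ⟨hshift, θ, hθ⟩ := h.exists_hasShift
  have := hasBinaryBiproducts_of_essSurj (FStable.quotientFunctor adjL)
  have hadd (n : ℤ) : (shiftFunctor (FStable adjL) n).Additive := shiftFunctor_additive n
  let Θ : h.ShiftData := ⟨θ, hθ⟩
  let toHull {X : A} (H : FInjectiveHull EA F R X) :
      (EA.fSplit adjL adjR).Hull (ImageSummand L) X :=
    ⟨H.I, H.T, H.i, H.p, H.zero, H.isFSplit, hLR ▸ H.isFInjective⟩
  refine ⟨hshift, hadd, Θ.pretriangulated, Θ.isTriangulated, fun H => θ (toHull H), ?_, ?_⟩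
  · intro X X' H H' f g k hg hk
    rw [hθ (toHull H) (toHull H'), h.suspMap_map (toHull H) (toHull H') f g k hg hk]
  · intro D
    constructor
    · rintro ⟨S, hS, H, s, w, hs, hw, e⟩
      exact ⟨S, hS, ⟨H.I, H.T, H.i, H.p, H.zero, H.exact, hLR ▸ H.mem⟩, s, w, hs, hw, e⟩
    · rintro ⟨S, hS, H, s, w, hs, hw, e⟩
      exact ⟨S, hS, toHull H, s, w, hs, hw, e⟩
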